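/- Let $K$ be a simply connected compact Lie group with Lie algebra $\mathfrak k$, let $\mathfrak t\subset\mathfrak k$ be a maximal abelian subalgebra, $T=\exp\mathfrak t$, $W=N_K(T)/T$, $\mathfrak h=\mathfrak t^{\mathbb C}$, and fix a system of positive roots (the roots positive on a Weyl chamber), with the corresponding triangular decomposition $\mathfrak k^{\mathbb C}=\mathfrak n^-\oplus\mathfrak h\oplus\mathfrak n^+$. Let $\mathcal H(x_-+x_0+x_+)=-ix_-+ix_+$ be the Hilbert transform; it preserves $\mathfrak k$ and is skew for the Killing form $\langle\cdot,\cdot\rangle$. Identifying $\mathfrak k^*$ with $\mathfrak k$ by the Killing form, view $\mathcal H$ as the element $(\phi,\psi)\mapsto\langle\mathcal H\phi,\psi\rangle$ of $\mathfrak k\wedge\mathfrak k$, and let $\mathcal H^r$ and $\mathcal H^l$ be the right and left invariant bivector fields on $K$ that it generates. Let $\pi_K=\mathcal H^r-\mathcal H^l$ (the standard Poisson Lie group structure) and $\Pi_K=\mathcal H^r+\mathcal H^l$ (the Evens–Lu Poisson structure). Let $\mathbf w_0\in N_K(T)$ be a representative of the longest element of $W$, i.e. of the element of maximal length, the length of $w\in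 W$ being the number of positive roots that $w$ maps to negative roots. Then: 1. $L_{\mathbf w_0}\colon K\to K$, $k\mapsto \mathbf w_0k$, is a diffeomorphism, and it carries $\pi_K$ onto $-\Pi_K$: $(L_{\mathbf w_0})_*\pi_K=-\Pi_K$. 2. $L_{\mathbf w_0}$ exchanges the Bruhat and Birkhoff decompositions of $K$: let $G=K^{\mathbb C}$ be the complexification of $K$, $N^\pm=\exp\mathfrak n^\pm$ and $H=\exp\mathfrak h$. For every $\mathbf w\in N_K(T)$, $$L_{\mathbf w_0}\bigl(K\cap N^+\mathbf wHN^+\bigr)=K\cap N^-\mathbf w_0\mathbf wHN^+,\qquad L_{\mathbf w_0}\bigl(K\cap N^-\mathbf wHN^+\bigr)=K\cap N^+\mathbf w_0\mathbf wHN^+ .$$ -/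

import Mathlib

open scoped TensorProduct Manifold ContDiff

noncomputable section

namespace CompactPoisson

/-! ### Triangular decompositions of a real Lie algebra of compact type -/

section Algebra

variable {L : Type*} [LieRing L] [LieAlgebra ℝ L]

/-- For a subspace `t` of `L` and a real functional `lam` on `t`, the simultaneous eigenspace
`{Z ∈ L_ℂ | [X, Z] = i lam(X) Z for all X ∈ t}` in the complexification `L_ℂ = ℂ ⊗ L`.
(Roots of a compact Lie algebra are imaginary on `t`; `i lam` is the root in question.) -/
def rootSpace (t : Submodule ℝ L) (lam : Module.Dual ℝ t) : Submodule ℂ (ℂ ⊗[ℝ] L) :=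
  ⨅ X : t, (LieAlgebra.ad ℂ (ℂ ⊗[ℝ] L) ((1 : ℂ) ⊗ₜ[ℝ] (X : L))).eigenspace
    (Complex.I * (lam X : ℂ))

lemma mem_rootSpace {t : Submodule ℝ L} {lam : Module.Dual ℝ t} {Z : ℂ ⊗[ℝ] L} :
    Z ∈ rootSpace t lam ↔ ∀ X : t, LieAlgebra.ad ℂ (ℂ ⊗[ℝ] L) ((1 : ℂ) ⊗ₜ[ℝ] (X : L)) Z =
      (Complex.I * (lam X : ℂ)) • Z := by
  simp only [rootSpace, Submodule.mem_iInf, Module.End.mem_eigenspace_iff]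

/-- `lam` is a (real) root: it is nonzero and has a nonzero root space. -/
def IsRoot (t : Submodule ℝ L) (lam : Module.Dual ℝ t) : Prop :=
  lam ≠ 0 ∧ rootSpace t lam ≠ ⊥

variable (L) in
/-- A triangular decomposition `L_ℂ = n⁻ ⊕ t_ℂ ⊕ n⁺` of the complexification of `L`: a maximal
abelian subalgebra `t` of `L`, and a system of positive roots (those positive on a Weyl chamber),
`n⁺` (resp. `n⁻`) being the sum of the root spaces of the positive (resp. negative) roots. -/
structure TriangularDecomposition where
  /-- the maximal abelian subalgebra -/
  t : Submodule ℝ L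
  abelian : ∀ X ∈ t, ∀ Y ∈ t, ⁅X, Y⁆ = 0
  maximal : ∀ X : L, (∀ Y ∈ t, ⁅X, Y⁆ = 0) → X ∈ t
  /-- the positive roots -/
  pos : Set (Module.Dual ℝ t)
  exists_chamber : ∃ X₀ : t, (∀ lam, IsRoot t lam → lam X₀ ≠ 0) ∧
    pos = {lam | IsRoot t lam ∧ 0 < lam X₀}
  isCompl_pos : IsCompl (⨆ lam ∈ pos, rootSpace t lam)
    (t.baseChange ℂ ⊔ ⨆ lam ∈ pos, rootSpace t (-lam))
  isCompl_neg : IsCompl (⨆ lam ∈ pos, rootSpace t (-lam))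
    (t.baseChange ℂ ⊔ ⨆ lam ∈ pos, rootSpace t lam)

namespace TriangularDecomposition

variable (D : TriangularDecomposition L)

/-- The Cartan subalgebra `h = t_ℂ`. -/
def h : Submodule ℂ (ℂ ⊗[ℝ] L) := D.t.baseChange ℂ

/-- The nilpotent subalgebra `n⁺`. -/
def nPos : Submodule ℂ (ℂ ⊗[ℝ] L) := ⨆ lam ∈ D.pos, rootSpace D.t lam

/-- The nilpotent subalgebra `n⁻`. -/
def nNeg : Submodule ℂ (ℂ ⊗[ℝ] L) := ⨆ lam ∈ D.pos, rootSpace D.t (-lam)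

/-- The Hilbert transform `x₋ + x₀ + x₊ ↦ -i x₋ + i x₊` on `L_ℂ`. -/
def hilbert : (ℂ ⊗[ℝ] L) →ₗ[ℂ] (ℂ ⊗[ℝ] L) :=
  Complex.I • Submodule.projection _ _ D.isCompl_pos -
    Complex.I • Submodule.projection _ _ D.isCompl_neg

end TriangularDecomposition

variable (L) in
/-- The inclusion of `L` in its complexification. -/
def incl : L →ₗ[ℝ] ℂ ⊗[ℝ] L := TensorProduct.mk ℝ ℂ L 1

variable (L) in
/-- The real part `L_ℂ → L`, with kernel `i L`. -/
def realPart : (ℂ ⊗[ℝ] L) →ₗ[ℝ] L :=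
  (TensorProduct.lid ℝ L).toLinearMap ∘ₗ Complex.reLm.rTensor L

/-- The Hilbert transform as an operator on `L` (it preserves `L ⊆ L_ℂ`, see
`incl_hilbertReal`). -/
def TriangularDecomposition.hilbertReal (D : TriangularDecomposition L) : L →ₗ[ℝ] L :=
  realPart L ∘ₗ D.hilbert.restrictScalars ℝ ∘ₗ incl L

variable (L) in
/-- Complex conjugation of `L_ℂ` with respect to `L`. -/
def conj : (ℂ ⊗[ℝ] L) →ₗ[ℝ] (ℂ ⊗[ℝ] L) := Complex.conjAe.toLinearMap.rTensor L

lemma conj_smul (c : ℂ) (Z : ℂ ⊗[ℝ] L) :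
    conj L (c • Z) = (starRingEnd ℂ) c • conj L Z := by
  induction Z with
  | zero => simp
  | tmul z X => simp [conj, TensorProduct.smul_tmul']
  | add a b ha hb => simp [ha, hb]

lemma conj_ad (X : L) (Z : ℂ ⊗[ℝ] L) :
    conj L (LieAlgebra.ad ℂ (ℂ ⊗[ℝ] L) ((1 : ℂ) ⊗ₜ[ℝ] X) Z) =
      LieAlgebra.ad ℂ (ℂ ⊗[ℝ] L) ((1 : ℂ) ⊗ₜ[ℝ] X) (conj L Z) := by
  induction Z with
  | zero => simp
  | tmul z Y => simp [conj]
  | add a b ha hb => simp only [map_add, ha, hb]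

lemma conj_mem_rootSpace {t : Submodule ℝ L} {lam : Module.Dual ℝ t} {Z : ℂ ⊗[ℝ] L}
    (hZ : Z ∈ rootSpace t lam) : conj L Z ∈ rootSpace t (-lam) := by
  rw [mem_rootSpace] at hZ ⊢
  intro X
  rw [← conj_ad, hZ X, conj_smul]
  simp

lemma incl_realPart_of_conj {Z : ℂ ⊗[ℝ] L} (hZ : conj L Z = Z) : incl L (realPart L Z) = Z := by
  have key : ∀ W : ℂ ⊗[ℝ] L, (2 : ℂ) • incl L (realPart L W) = W + conj L W := by
    intro W
    induction W with
    | zero => simp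
    | tmul z Y =>
      simp only [incl, realPart, conj, LinearMap.comp_apply, LinearMap.rTensor_tmul,
        LinearEquiv.coe_coe, TensorProduct.lid_tmul, TensorProduct.mk_apply,
        TensorProduct.tmul_smul, ← TensorProduct.add_tmul]
      rw [TensorProduct.smul_tmul', TensorProduct.smul_tmul']
      congr 1
      apply Complex.ext <;> simp [two_mul]
    | add a b ha hb => rw [map_add, map_add, smul_add, ha, hb, map_add]; abel
  have h2 := key Z
  rw [hZ, ← two_smul ℂ Z] at h2
  exact smul_right_injective _ (two_ne_zero : (2 : ℂ) ≠ 0) h2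

namespace TriangularDecomposition

variable (D : TriangularDecomposition L)

lemma hilbert_of_mem_nPos {Z : ℂ ⊗[ℝ] L} (hZ : Z ∈ D.nPos) : D.hilbert Z = Complex.I • Z := by
  have h1 := Submodule.projection_apply_left D.isCompl_pos ⟨Z, hZ⟩
  have h2 := (Submodule.projection_apply_eq_zero_iff D.isCompl_neg (x := Z)).2
    (Submodule.mem_sup_right hZ)
  simp only at h1
  simp [hilbert, h1, h2]

lemma hilbert_of_mem_nNeg {Z : ℂ ⊗[ℝ] L} (hZ : Z ∈ D.nNeg) : D.hilbert Z = -(Complex.I • Z) := by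
  have h1 := Submodule.projection_apply_left D.isCompl_neg ⟨Z, hZ⟩
  have h2 := (Submodule.projection_apply_eq_zero_iff D.isCompl_pos (x := Z)).2
    (Submodule.mem_sup_right hZ)
  simp only at h1
  simp [hilbert, h1, h2]

lemma hilbert_of_mem_h {Z : ℂ ⊗[ℝ] L} (hZ : Z ∈ D.h) : D.hilbert Z = 0 := by
  have h1 := (Submodule.projection_apply_eq_zero_iff D.isCompl_neg (x := Z)).2
    (Submodule.mem_sup_left hZ)
  have h2 := (Submodule.projection_apply_eq_zero_iff D.isCompl_pos (x := Z)).2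
    (Submodule.mem_sup_left hZ)
  simp [hilbert, h1, h2]

lemma exists_components (Z : ℂ ⊗[ℝ] L) :
    ∃ a ∈ D.nNeg, ∃ b ∈ D.h, ∃ c ∈ D.nPos, a + b + c = Z := by
  have h1 : Z ∈ (⨆ lam ∈ D.pos, rootSpace D.t lam) ⊔
      (D.t.baseChange ℂ ⊔ ⨆ lam ∈ D.pos, rootSpace D.t (-lam)) := by
    rw [D.isCompl_pos.sup_eq_top]; trivial
  obtain ⟨c, hc, d, hd, rfl⟩ := Submodule.mem_sup.1 h1
  obtain ⟨b, hb, a, ha, rfl⟩ := Submodule.mem_sup.1 hd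
  exact ⟨a, ha, b, hb, c, hc, by abel⟩

lemma conj_mem_nNeg {Z : ℂ ⊗[ℝ] L} (hZ : Z ∈ D.nPos) : conj L Z ∈ D.nNeg := by
  have : D.nPos.restrictScalars ℝ ≤ (D.nNeg.restrictScalars ℝ).comap (conj L) := by
    intro W hW
    refine Submodule.iSup_induction' (p := fun lam => ⨆ (_ : lam ∈ D.pos), rootSpace D.t lam)
      (motive := fun W _ => conj L W ∈ D.nNeg) ?_ ?_ ?_ hW
    · intro lam x hx
      by_cases hl : lam ∈ D.pos
      · rw [iSup_pos hl] at hx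
        exact Submodule.mem_iSup_of_mem lam (Submodule.mem_iSup_of_mem hl (conj_mem_rootSpace hx))
      · rw [iSup_neg hl, Submodule.mem_bot] at hx
        simp [hx]
    · simp
    · intro x y _ _ hx hy
      rw [map_add]; exact add_mem hx hy
  exact this hZ

lemma conj_mem_nPos {Z : ℂ ⊗[ℝ] L} (hZ : Z ∈ D.nNeg) : conj L Z ∈ D.nPos := by
  have : D.nNeg.restrictScalars ℝ ≤ (D.nPos.restrictScalars ℝ).comap (conj L) := by
    intro W hW
    refine Submodule.iSup_induction' (p := fun lam => ⨆ (_ : lam ∈ D.pos), rootSpace D.t (-lam))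
      (motive := fun W _ => conj L W ∈ D.nPos) ?_ ?_ ?_ hW
    · intro lam x hx
      by_cases hl : lam ∈ D.pos
      · rw [iSup_pos hl] at hx
        have := conj_mem_rootSpace hx
        rw [neg_neg] at this
        exact Submodule.mem_iSup_of_mem lam (Submodule.mem_iSup_of_mem hl this)
      · rw [iSup_neg hl, Submodule.mem_bot] at hx
        simp [hx]
    · simp
    · intro x y _ _ hx hy
      rw [map_add]; exact add_mem hx hy
  exact this hZ

lemma conj_mem_h {Z : ℂ ⊗[ℝ] L} (hZ : Z ∈ D.h) : conj L Z ∈ D.h := by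
  rw [h, Submodule.baseChange_eq_span] at hZ
  refine Submodule.span_induction (p := fun Z _ => conj L Z ∈ D.h) ?_ ?_ ?_ ?_ hZ
  · rintro _ ⟨X, hX, rfl⟩
    have : conj L ((1 : ℂ) ⊗ₜ[ℝ] X) = (1 : ℂ) ⊗ₜ[ℝ] X := by simp [conj]
    simp only [TensorProduct.mk_apply]
    rw [this]
    exact Submodule.tmul_mem_baseChange_of_mem 1 hX
  · simp
  · intro x y _ _ hx hy
    rw [map_add]; exact add_mem hx hy
  · intro c x _ hx
    rw [conj_smul]; exact Submodule.smul_mem _ _ hx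

lemma hilbert_conj (Z : ℂ ⊗[ℝ] L) : D.hilbert (conj L Z) = conj L (D.hilbert Z) := by
  obtain ⟨a, ha, b, hb, c, hc, rfl⟩ := D.exists_components Z
  simp only [map_add, D.hilbert_of_mem_nPos (D.conj_mem_nPos ha), D.hilbert_of_mem_nNeg ha,
    D.hilbert_of_mem_h (D.conj_mem_h hb), D.hilbert_of_mem_h hb,
    D.hilbert_of_mem_nNeg (D.conj_mem_nNeg hc), D.hilbert_of_mem_nPos hc, map_neg, conj_smul,
    Complex.conj_I, neg_smul, neg_neg, map_zero]

/-- The Hilbert transform preserves the real form `L`. -/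
theorem incl_hilbertReal (X : L) : incl L (D.hilbertReal X) = D.hilbert (incl L X) := by
  refine incl_realPart_of_conj ?_
  change conj L (D.hilbert (incl L X)) = D.hilbert (incl L X)
  rw [← hilbert_conj]
  congr 1
  simp [conj, incl]

lemma killing_ad (X Y Z : ℂ ⊗[ℝ] L) :
    killingForm ℂ (ℂ ⊗[ℝ] L) (LieAlgebra.ad ℂ (ℂ ⊗[ℝ] L) X Y) Z =
      -killingForm ℂ (ℂ ⊗[ℝ] L) Y (LieAlgebra.ad ℂ (ℂ ⊗[ℝ] L) X Z) := by
  have h1 := LieModule.traceForm_apply_lie_apply ℂ (ℂ ⊗[ℝ] L) (ℂ ⊗[ℝ] L) Y X Z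
  rw [LieAlgebra.ad_apply, LieAlgebra.ad_apply, ← lie_skew, map_neg, LinearMap.neg_apply]
  exact congrArg Neg.neg h1

lemma killing_rootSpace {t : Submodule ℝ L} {lam mu : Module.Dual ℝ t} {X₀ : t}
    (hne : lam X₀ + mu X₀ ≠ 0) {Y Z : ℂ ⊗[ℝ] L} (hY : Y ∈ rootSpace t lam)
    (hZ : Z ∈ rootSpace t mu) : killingForm ℂ (ℂ ⊗[ℝ] L) Y Z = 0 := by
  have h1 := killing_ad ((1 : ℂ) ⊗ₜ[ℝ] (X₀ : L)) Y Z
  rw [mem_rootSpace.1 hY X₀, mem_rootSpace.1 hZ X₀, map_smul, map_smul, LinearMap.smul_apply,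
    smul_eq_mul, smul_eq_mul] at h1
  have h2 : Complex.I * ((lam X₀ + mu X₀ : ℝ) : ℂ) * killingForm ℂ (ℂ ⊗[ℝ] L) Y Z = 0 := by
    push_cast
    linear_combination h1
  have h3 : Complex.I * ((lam X₀ + mu X₀ : ℝ) : ℂ) ≠ 0 :=
    mul_ne_zero Complex.I_ne_zero (by exact_mod_cast hne)
  exact (mul_eq_zero.1 h2).resolve_left h3

lemma h_le : D.h ≤ rootSpace D.t 0 := by
  rw [h, Submodule.baseChange_eq_span, Submodule.span_le]
  rintro _ ⟨Y, hY, rfl⟩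
  rw [SetLike.mem_coe, mem_rootSpace]
  intro X
  simp [D.abelian X X.2 Y hY]

lemma killing_iSup {s s' : Set (Module.Dual ℝ D.t)} {f g : Module.Dual ℝ D.t → Module.Dual ℝ D.t}
    {X₀ : D.t} (hne : ∀ lam ∈ s, ∀ mu ∈ s', f lam X₀ + g mu X₀ ≠ 0) {Y Z : ℂ ⊗[ℝ] L}
    (hY : Y ∈ ⨆ lam ∈ s, rootSpace D.t (f lam)) (hZ : Z ∈ ⨆ mu ∈ s', rootSpace D.t (g mu)) :
    killingForm ℂ (ℂ ⊗[ℝ] L) Y Z = 0 := by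
  have h1 : ∀ lam ∈ s, ∀ Y' ∈ rootSpace D.t (f lam), killingForm ℂ (ℂ ⊗[ℝ] L) Y' Z = 0 := by
    intro lam hl Y' hY'
    have : (⨆ mu ∈ s', rootSpace D.t (g mu)) ≤ LinearMap.ker (killingForm ℂ (ℂ ⊗[ℝ] L) Y') :=
      iSup₂_le fun mu hm Z' hZ' => killing_rootSpace (hne lam hl mu hm) hY' hZ'
    exact this hZ
  have : (⨆ lam ∈ s, rootSpace D.t (f lam)) ≤
      LinearMap.ker ((killingForm ℂ (ℂ ⊗[ℝ] L)).flip Z) :=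
    iSup₂_le fun lam hl Y' hY' => h1 lam hl Y' hY'
  exact this hY

/-- The Hilbert transform is skew for the Killing form. -/
lemma killing_hilbert_self (Z : ℂ ⊗[ℝ] L) : killingForm ℂ (ℂ ⊗[ℝ] L) (D.hilbert Z) Z = 0 := by
  obtain ⟨a, ha, b, hb, c, hc, rfl⟩ := D.exists_components Z
  obtain ⟨X₀, -, hpos⟩ := D.exists_chamber
  have hP : ∀ lam ∈ D.pos, 0 < lam X₀ := by
    intro lam hl
    rw [hpos] at hl
    exact hl.2
  have hb' : b ∈ ⨆ lam ∈ ({0} : Set (Module.Dual ℝ D.t)), rootSpace D.t (id lam) := by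
    simpa using D.h_le hb
  have haa : killingForm ℂ (ℂ ⊗[ℝ] L) a a = 0 :=
    D.killing_iSup (f := fun lam => -lam) (g := fun lam => -lam) (X₀ := X₀)
      (fun lam hl mu hm => by
        have := hP lam hl; have := hP mu hm
        simp only [LinearMap.neg_apply]; linarith) ha ha
  have hcc : killingForm ℂ (ℂ ⊗[ℝ] L) c c = 0 :=
    D.killing_iSup (f := fun lam => lam) (g := fun lam => lam) (X₀ := X₀)
      (fun lam hl mu hm => by
        have := hP lam hl; have := hP mu hm
        linarith) hc hc
  have hab : killingForm ℂ (ℂ ⊗[ℝ] L) a b = 0 :=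
    D.killing_iSup (f := fun lam => -lam) (g := id) (X₀ := X₀)
      (fun lam hl mu hm => by
        have := hP lam hl
        rw [Set.mem_singleton_iff] at hm
        subst hm
        simp only [LinearMap.neg_apply, id, LinearMap.zero_apply]; linarith) ha hb'
  have hcb : killingForm ℂ (ℂ ⊗[ℝ] L) c b = 0 :=
    D.killing_iSup (f := fun lam => lam) (g := id) (X₀ := X₀)
      (fun lam hl mu hm => by
        have := hP lam hl
        rw [Set.mem_singleton_iff] at hm
        subst hm
        simp only [id, LinearMap.zero_apply]; linarith) hc hb'
  have hac : killingForm ℂ (ℂ ⊗[ℝ] L) c a = killingForm ℂ (ℂ ⊗[ℝ] L) a c :=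
    LieModule.traceForm_comm ℂ (ℂ ⊗[ℝ] L) (ℂ ⊗[ℝ] L) c a
  simp only [map_add, D.hilbert_of_mem_nPos hc, D.hilbert_of_mem_nNeg ha, D.hilbert_of_mem_h hb,
    map_neg, map_smul, LinearMap.add_apply, LinearMap.neg_apply, LinearMap.smul_apply, haa, hcc,
    hab, hcb, hac, smul_eq_mul, map_zero, LinearMap.zero_apply]
  ring

lemma killing_hilbertReal_self [FiniteDimensional ℝ L] (X : L) : killingForm ℝ L (D.hilbertReal X) X = 0 := by
  have h1 := D.killing_hilbert_self (incl L X)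
  rw [← incl_hilbertReal] at h1
  have h2 : killingForm ℂ (ℂ ⊗[ℝ] L) (incl L (D.hilbertReal X)) (incl L X) =
      ((killingForm ℝ L (D.hilbertReal X) X : ℝ) : ℂ) := by
    rw [show killingForm ℂ (ℂ ⊗[ℝ] L) = (killingForm ℝ L).baseChange ℂ from
      LieModule.traceForm_baseChange ℝ L L ℂ]
    simp [incl]
  rw [h2] at h1
  exact_mod_cast h1

end TriangularDecomposition

/-- The identification `L* ≃ L` given by the Killing form (which is nondegenerate when `L` is
semisimple). -/
def killingSharp : Module.Dual ℝ L →ₗ[ℝ] L :=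
  open Classical in
  if hb : Function.Bijective (killingForm ℝ L) then
    (LinearEquiv.ofBijective (killingForm ℝ L) hb).symm.toLinearMap
  else 0

/-- Bivectors on a finite-dimensional real vector space `V`, as alternating bilinear forms
on `V*`. -/
abbrev Bivector (V : Type*) [AddCommGroup V] [Module ℝ V] : Type _ :=
  (Module.Dual ℝ V) [⋀^Fin 2]→ₗ[ℝ] ℝ

/-- Pushforward of a bivector by a linear map: `(A_* B)(φ, ψ) = B(φ ∘ A, ψ ∘ A)`. -/
def Bivector.push {V V' : Type*} [AddCommGroup V] [Module ℝ V] [AddCommGroup V'] [Module ℝ V']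
    (A : V →ₗ[ℝ] V') (B : Bivector V) : Bivector V' :=
  B.compLinearMap A.dualMap

/-- The Hilbert transform as an element of `L ∧ L`, by means of the Killing form `⟨ , ⟩`:
`(φ, ψ) ↦ ⟨H φ, ψ⟩` under `L* ≃ L`. -/
def TriangularDecomposition.hilbertBivector [FiniteDimensional ℝ L]
    (D : TriangularDecomposition L) : Bivector L where
  toFun v := killingForm ℝ L (D.hilbertReal (killingSharp (v 0))) (killingSharp (v 1))
  map_update_add' := by
    intro _ v i x y
    fin_cases i <;> simp [Function.update]
  map_update_smul' := by
    intro _ v i c x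
    fin_cases i <;> simp [Function.update]
  map_eq_zero_of_eq' := by
    intro v i j hij hne
    have h01 : v 0 = v 1 := by
      fin_cases i <;> fin_cases j <;> simp_all
    rw [h01]
    exact D.killing_hilbertReal_self _

end Algebra

/-! ### Lie groups -/

section Group

variable {E : Type*} [NormedAddCommGroup E] [NormedSpace ℝ E]
  {K : Type*} [TopologicalSpace K] [ChartedSpace E K] [Group K]

instance [LieGroup 𝓘(ℝ, E) ∞ K] : LieGroup 𝓘(ℝ, E) (minSmoothness ℝ 3) K :=
  LieGroup.of_le (n := ∞) (by
    rw [minSmoothness_of_isRCLikeNormedField]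
    exact WithTop.coe_le_coe.2 le_top)

instance [FiniteDimensional ℝ E] : FiniteDimensional ℝ (GroupLieAlgebra 𝓘(ℝ, E) K) :=
  inferInstanceAs (FiniteDimensional ℝ E)

/-- `exp S`, for a set `S` of tangent vectors at the identity: the elements `γ 1`, for `γ` a smooth
one-parameter subgroup with `γ' 0 ∈ S`. -/
def expSet (S : Set (GroupLieAlgebra 𝓘(ℝ, E) K)) : Set K :=
  {g | ∃ γ : ℝ → K, ContMDiff 𝓘(ℝ, ℝ) 𝓘(ℝ, E) ∞ γ ∧ (∀ a b, γ (a + b) = γ a * γ b) ∧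
    (mfderiv 𝓘(ℝ, ℝ) 𝓘(ℝ, E) γ 0 (1 : ℝ) : E) ∈ S ∧ γ 1 = g}

/-- `Ad k`, the derivative at the identity of conjugation by `k`. -/
def Ad (k : K) : GroupLieAlgebra 𝓘(ℝ, E) K →ₗ[ℝ] GroupLieAlgebra 𝓘(ℝ, E) K :=
  (mfderiv 𝓘(ℝ, E) 𝓘(ℝ, E) (fun g : K => k * g * k⁻¹) 1 : E →L[ℝ] E).toLinearMap

variable (E K) in
/-- A bivector field on `K`. -/
abbrev BivectorField : Type _ := ∀ k : K, Bivector (TangentSpace 𝓘(ℝ, E) k)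

/-- The left-invariant bivector field generated by `r`. -/
def leftInvariant (r : Bivector (GroupLieAlgebra 𝓘(ℝ, E) K)) : BivectorField E K := fun k =>
  Bivector.push (V' := TangentSpace 𝓘(ℝ, E) k)
    (mfderiv 𝓘(ℝ, E) 𝓘(ℝ, E) (fun g : K => k * g) 1 : E →L[ℝ] E).toLinearMap r

/-- The right-invariant bivector field generated by `r`. -/
def rightInvariant (r : Bivector (GroupLieAlgebra 𝓘(ℝ, E) K)) : BivectorField E K := fun k =>
  Bivector.push (V' := TangentSpace 𝓘(ℝ, E) k)
    (mfderiv 𝓘(ℝ, E) 𝓘(ℝ, E) (fun g : K => g * k) 1 : E →L[ℝ] E).toLinearMap r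

/-- The diffeomorphism `Φ` carries the bivector field `P` onto `Q`: `Φ_* P = Q`. -/
def Carries (Φ : K ≃ₘ⟮𝓘(ℝ, E), 𝓘(ℝ, E)⟯ K) (P Q : BivectorField E K) : Prop :=
  ∀ k : K, Bivector.push (mfderiv 𝓘(ℝ, E) 𝓘(ℝ, E) Φ k).toLinearMap (P k) = Q (Φ k)

section Structures

variable [FiniteDimensional ℝ E] [LieGroup 𝓘(ℝ, E) ∞ K]
  (D : TriangularDecomposition (GroupLieAlgebra 𝓘(ℝ, E) K))

/-- The standard Poisson Lie group structure `π_K = Hʳ - Hˡ`. -/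
def standardPoisson : BivectorField E K :=
  rightInvariant D.hilbertBivector - leftInvariant D.hilbertBivector

/-- The Evens-Lu Poisson structure `Π_K = Hʳ + Hˡ`. -/
def evensLu : BivectorField E K :=
  rightInvariant D.hilbertBivector + leftInvariant D.hilbertBivector

/-- The maximal torus `T = exp t`. -/
def torus : Set K := expSet (D.t : Set (GroupLieAlgebra 𝓘(ℝ, E) K))

/-- The normalizer `N_K(T)`; the Weyl group is `W = N_K(T) / T`. -/
def torusNormalizer : Subgroup K := Subgroup.normalizer (torus D)

/-- The positive roots `lam` that `w ∈ N_K(T)` maps to negative roots: `w · lam = -mu` with `mu`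
positive, where `(w · lam) (Ad w X) = lam X`. -/
def inversions (w : K) : Set (Module.Dual ℝ D.t) :=
  {lam ∈ D.pos | ∃ mu ∈ D.pos, ∀ X Y : D.t,
    (Y : GroupLieAlgebra 𝓘(ℝ, E) K) = Ad w (X : GroupLieAlgebra 𝓘(ℝ, E) K) → mu Y = -lam X}

/-- The length of the class of `w ∈ N_K(T)` in the Weyl group: the number of positive roots that
it makes negative. -/
def weylLength (w : K) : ℕ := (inversions D w).ncard

/-- `w ∈ N_K(T)` represents the longest element of the Weyl group `N_K(T) / T`. -/
def IsLongestRep (w : K) : Prop :=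
  w ∈ torusNormalizer D ∧ ∀ v ∈ torusNormalizer D, weylLength D v ≤ weylLength D w

end Structures

section Complexification

variable {F : Type*} [NormedAddCommGroup F] [NormedSpace ℂ F]
  {G : Type*} [TopologicalSpace G] [ChartedSpace F G] [Group G]

/-- The complex-linear extension `k_ℂ → g` of the differential of `ι : K → G` at the identity. -/
def diffC (ι : K →* G) : (ℂ ⊗[ℝ] GroupLieAlgebra 𝓘(ℝ, E) K) →ₗ[ℂ] F :=
  let d : GroupLieAlgebra 𝓘(ℝ, E) K →L[ℝ] F := mfderiv 𝓘(ℝ, E) 𝓘(ℝ, F) ι 1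
  LinearMap.liftBaseChange ℂ d.toLinearMap

variable (E F) in
/-- `ι : K → G` is a complexification of the simply connected group `K`: `G` is a simply connected
complex Lie group and `ι` a smooth homomorphism whose differential induces an isomorphism of
`ℂ ⊗ Lie K` onto `Lie G`. -/
structure IsComplexification (ι : K →* G) : Prop where
  lieGroup : LieGroup 𝓘(ℂ, F) ∞ G
  simplyConnected : SimplyConnectedSpace G
  smooth : ContMDiff 𝓘(ℝ, E) 𝓘(ℝ, F) ∞ ι
  bijective : Function.Bijective (diffC (E := E) (F := F) ι)

variable [FiniteDimensional ℝ E] [LieGroup 𝓘(ℝ, E) ∞ K]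
  (D : TriangularDecomposition (GroupLieAlgebra 𝓘(ℝ, E) K))

variable (F) in
/-- `exp s ⊆ G` for a subspace `s` of `k_ℂ = g`. -/
def expG (ι : K →* G) (s : Submodule ℂ (ℂ ⊗[ℝ] GroupLieAlgebra 𝓘(ℝ, E) K)) : Set G :=
  expSet (E := F) (diffC (E := E) (F := F) ι '' s)

open scoped Pointwise

variable (F) in
/-- The stratum `K ∩ N⁺ w H N⁺` of the Bruhat decomposition of `K`, with `N⁺ = exp n⁺` and
`H = exp h`; here `N⁺ w H N⁺ = B⁺ w B⁺` for `B⁺ = H N⁺`. -/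
def bruhat (ι : K →* G) (w : K) : Set K :=
  ι ⁻¹' (expG F ι D.nPos * {ι w} * expG F ι D.h * expG F ι D.nPos)

variable (F) in
/-- The stratum `K ∩ N⁻ w H N⁺` of the Birkhoff decomposition of `K`. -/
def birkhoff (ι : K →* G) (w : K) : Set K :=
  ι ⁻¹' (expG F ι D.nNeg * {ι w} * expG F ι D.h * expG F ι D.nPos)

end Complexification

end Group

end CompactPoisson

end

/-!
Everything follows from one property of `w₀`: the adjoint action `A = Ad w₀` preserves `t` and sends
every positive root to a negative one (`TriangularDecomposition.Reverses`). Then `A` exchanges `n⁺`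
and `n⁻` and preserves `h`, so it anticommutes with the Hilbert transform; as the Killing form is
invariant under automorphisms, `A` sends the bivector of the Hilbert transform to its opposite
(`TriangularDecomposition.Reverses.push_hilbertBivector`). Left translation by `w₀` fixes the
left-invariant field `Hˡ`, and, since `w₀ (g k) = (w₀ g w₀⁻¹) (w₀ k)`, it sends the right-invariant
field `Hʳ` generated by `H` to the one generated by `A H = -H`. Hence `Hʳ - Hˡ` goes to
`-(Hʳ + Hˡ)`. In the complex group, conjugation by `w₀` exchanges `exp n⁺` and `exp n⁻`, because the
complex-linear extension of `dι` intertwines the adjoint actions (`adC_diffC`); since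
`w₀ (n w h n') = (w₀ n w₀⁻¹) (w₀ w) h n'`, the two kinds of strata are exchanged.

The longest element is only given as one of maximal length, so what has to be shown is that the
maximal length is the number of positive roots, that is, that some element of `N_K(T)` makes all the
positive roots negative (`exists_pos_subset_inversions`). The general theory of Weyl groups is not
needed for this. Following Hunt's variational argument, let `⟨ , ⟩` be an `Ad`-invariant inner
product on the Lie algebra (`exists_invariant_form`, by Haar averaging), let `X₀` be a point of the
Weyl chamber, and let `k` minimize `⟨Ad(k) X₀, X₀⟩` over the compact group. The first-order
condition says that `Ad(k) X₀` commutes with `X₀`; as `X₀` is regular, its centralizer is `t`, so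
`Ad(k)` preserves `t`. The second-order condition along the plane of a root `k · lam`, with `lam`
positive, says that `lam(X₀) · (k · lam)(X₀) ≤ 0`, so `k · lam` is negative. A representative `w₀`
of an element of maximal length then inverts as many roots as `k`, that is, all the positive ones,
which are finite in number (`IsLongestRep.reverses`).

The variational argument uses Lie theory that is developed from the definition of the Lie bracket by
left-invariant vector fields: the derivative of `Ad` along a curve through the unit is the bracket
(`hasDerivAt_Ad`, which comes from a computation of second derivatives of the multiplication in a
chart, `fderiv_fderiv_conj`), every element of the Lie algebra is the velocity of a one-parameter
subgroup (`exists_isOneParam`), and `Ad k` is a Lie algebra automorphism (`Ad_lie`).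
-/

noncomputable section

namespace CompactPoisson

/-! ### Automorphisms of triangular decompositions -/

section Algebra

variable {L : Type*} [LieRing L] [LieAlgebra ℝ L]

lemma incl_apply (X : L) : incl L X = (1 : ℂ) ⊗ₜ[ℝ] X := rfl

lemma realPart_incl (X : L) : realPart L (incl L X) = X := by
  simp [incl, realPart]

lemma incl_injective : Function.Injective (incl L) :=
  Function.LeftInverse.injective realPart_incl

lemma realPart_ad (X : L) (Z : ℂ ⊗[ℝ] L) :
    realPart L (LieAlgebra.ad ℂ (ℂ ⊗[ℝ] L) ((1 : ℂ) ⊗ₜ[ℝ] X) Z) = ⁅X, realPart L Z⁆ := by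
  induction Z with
  | zero => simp
  | tmul z Y => simp [realPart]
  | add a b ha hb => simp only [map_add, ha, hb, lie_add]

lemma eq_incl_realPart_sub (Z : ℂ ⊗[ℝ] L) :
    Z = incl L (realPart L Z) - Complex.I • incl L (realPart L (Complex.I • Z)) := by
  induction Z with
  | zero => simp
  | tmul z Y =>
    simp only [incl, realPart, LinearMap.comp_apply, LinearMap.rTensor_tmul,
      LinearEquiv.coe_coe, TensorProduct.lid_tmul, TensorProduct.mk_apply,
      TensorProduct.tmul_smul, TensorProduct.smul_tmul', ← TensorProduct.sub_tmul]
    congr 1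
    apply Complex.ext <;> simp
  | add a b ha hb =>
    conv_lhs => rw [ha, hb]
    simp only [map_add, smul_add]
    abel

/-- A nonzero root vector of a root not vanishing at `X₀` gives a real rotation plane: vectors
`U`, `V` of `L` with `V ≠ 0`, `[X, U] = lam(X) V` and `[X, V] = -lam(X) U` for `X ∈ t`. -/
lemma exists_root_plane {t : Submodule ℝ L} {lam : Module.Dual ℝ t} (h : rootSpace t lam ≠ ⊥)
    {X₀ : t} (h0 : lam X₀ ≠ 0) :
    ∃ U V : L, V ≠ 0 ∧ (∀ X : t, ⁅(X : L), U⁆ = lam X • V) ∧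
      ∀ X : t, ⁅(X : L), V⁆ = -(lam X • U) := by
  obtain ⟨Z, hZ, hZ0⟩ := Submodule.exists_mem_ne_zero_of_ne_bot h
  rw [mem_rootSpace] at hZ
  have hr : ∀ (r : ℝ) (W : ℂ ⊗[ℝ] L), realPart L ((r : ℂ) • W) = r • realPart L W := by
    intro r W
    rw [← map_smul]
    congr 1
  have hU : ∀ X : t, ⁅(X : L), realPart L Z⁆ = lam X • realPart L (Complex.I • Z) := by
    intro X
    rw [← realPart_ad, hZ X, mul_comm, mul_smul, hr]
  have hV : ∀ X : t, ⁅(X : L), realPart L (Complex.I • Z)⁆ = -(lam X • realPart L Z) := by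
    intro X
    rw [← realPart_ad, map_smul, hZ X, smul_smul, ← mul_assoc, Complex.I_mul_I, neg_one_mul,
      neg_smul, map_neg, hr]
  refine ⟨realPart L Z, realPart L (Complex.I • Z), fun h1 => hZ0 ?_, hU, hV⟩
  have h2 := hV X₀
  rw [h1, lie_zero, eq_comm, neg_eq_zero] at h2
  have h3 := (smul_eq_zero.1 h2).resolve_left h0
  rw [eq_incl_realPart_sub Z, h1, h3]
  simp

namespace TriangularDecomposition

variable (D : TriangularDecomposition L)

lemma finite_pos [FiniteDimensional ℝ L] : D.pos.Finite := by
  obtain ⟨X₀, -, hpos⟩ := D.exists_chamber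
  let b := Module.finBasis ℝ D.t
  -- a root is determined by its values on a basis, and these values are eigenvalues
  let S : Set (Fin (Module.finrank ℝ D.t) → ℂ) := Set.univ.pi fun i =>
    {μ | (LieAlgebra.ad ℂ (ℂ ⊗[ℝ] L) ((1 : ℂ) ⊗ₜ[ℝ] (b i : L))).HasEigenvalue μ}
  have hS : S.Finite := Set.Finite.pi fun i => Module.End.finite_hasEigenvalue _
  refine Set.Finite.of_finite_image (f := fun lam i => Complex.I * (lam (b i) : ℂ))
    (hS.subset ?_) ?_
  · rintro _ ⟨lam, hl, rfl⟩ i -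
    rw [hpos] at hl
    obtain ⟨Z, hZ, hZ0⟩ := Submodule.exists_mem_ne_zero_of_ne_bot hl.1.2
    exact Module.End.hasEigenvalue_of_hasEigenvector (x := Z)
      ⟨Module.End.mem_eigenspace_iff.2 (mem_rootSpace.1 hZ (b i)), hZ0⟩
  · intro lam _ mu _ h
    refine b.ext fun i => ?_
    have := congrFun h i
    simpa using this

/-- The centralizer of an element `X₀` of `t` on which no root vanishes is `t`: the components in
`n⁻` and `n⁺` lie in sums of eigenspaces of `ad X₀` for nonzero eigenvalues. -/
lemma mem_t_of_lie_eq_zero {X₀ : D.t} (hreg : ∀ lam, IsRoot D.t lam → lam X₀ ≠ 0) {Z : L}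
    (hZ : ⁅(X₀ : L), Z⁆ = 0) : Z ∈ D.t := by
  obtain ⟨X₁, -, hpos⟩ := D.exists_chamber
  obtain ⟨a, ha, b, hb, c, hc, habc⟩ := D.exists_components (incl L Z)
  let N := LieAlgebra.ad ℂ (ℂ ⊗[ℝ] L) ((1 : ℂ) ⊗ₜ[ℝ] (X₀ : L))
  have hroot : ∀ lam ∈ D.pos, lam X₀ ≠ 0 := fun lam hl => by
    rw [hpos] at hl
    exact hreg lam hl.1
  have hle : ∀ lam : Module.Dual ℝ D.t, lam X₀ ≠ 0 →
      rootSpace D.t lam ≤ ⨆ μ, ⨆ (_ : μ ≠ (0 : ℂ)), N.eigenspace μ := by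
    intro lam hl
    refine le_trans (iInf_le _ X₀) (le_iSup₂_of_le (Complex.I * (lam X₀ : ℂ)) ?_ le_rfl)
    exact mul_ne_zero Complex.I_ne_zero (by exact_mod_cast hl)
  have ha' : a ∈ ⨆ μ, ⨆ (_ : μ ≠ (0 : ℂ)), N.eigenspace μ :=
    (iSup₂_le fun lam hl => hle (-lam) (by simpa using hroot lam hl) : D.nNeg ≤ _) ha
  have hc' : c ∈ ⨆ μ, ⨆ (_ : μ ≠ (0 : ℂ)), N.eigenspace μ :=
    (iSup₂_le fun lam hl => hle lam (hroot lam hl) : D.nPos ≤ _) hc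
  have hb0 : ∀ X : D.t, LieAlgebra.ad ℂ (ℂ ⊗[ℝ] L) ((1 : ℂ) ⊗ₜ[ℝ] (X : L)) b = 0 := fun X => by
    simpa using mem_rootSpace.1 (D.h_le hb) X
  have hac : a + c = incl L Z - b := by rw [← habc]; abel
  have hker : a + c ∈ N.eigenspace 0 := by
    rw [Module.End.mem_eigenspace_iff, hac, map_sub, hb0, zero_smul, sub_zero]
    simp [N, incl_apply, hZ]
  have hzero : a + c = 0 :=
    Submodule.disjoint_def.1 (N.eigenspaces_iSupIndep 0) _ hker (add_mem ha' hc')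
  rw [hac, sub_eq_zero] at hzero
  refine D.maximal Z fun Y hY => ?_
  have h1 := hb0 ⟨Y, hY⟩
  rw [← hzero] at h1
  apply incl_injective
  rw [map_zero, ← lie_skew, map_neg, neg_eq_zero]
  simpa [incl_apply] using h1

end TriangularDecomposition

lemma baseChange_ad (A : L ≃ₗ⁅ℝ⁆ L) (X : L) (Z : ℂ ⊗[ℝ] L) :
    (A : L →ₗ[ℝ] L).baseChange ℂ (LieAlgebra.ad ℂ (ℂ ⊗[ℝ] L) ((1 : ℂ) ⊗ₜ[ℝ] X) Z) =
      LieAlgebra.ad ℂ (ℂ ⊗[ℝ] L) ((1 : ℂ) ⊗ₜ[ℝ] (A X)) ((A : L →ₗ[ℝ] L).baseChange ℂ Z) := by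
  induction Z with
  | zero => simp
  | tmul z Y => simp [LieEquiv.map_lie]
  | add a b ha hb => simp only [map_add, ha, hb]

lemma baseChange_mem_rootSpace {t : Submodule ℝ L} (A : L ≃ₗ⁅ℝ⁆ L)
    (hA : ∀ X ∈ t, A.symm X ∈ t) {lam mu : Module.Dual ℝ t}
    (hmu : ∀ X Y : t, (Y : L) = A X → mu Y = lam X) {Z : ℂ ⊗[ℝ] L} (hZ : Z ∈ rootSpace t lam) :
    (A : L →ₗ[ℝ] L).baseChange ℂ Z ∈ rootSpace t mu := by
  rw [mem_rootSpace] at hZ ⊢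
  intro Y
  have h1 : (Y : L) = A (A.symm Y) := (A.apply_symm_apply _).symm
  have h2 := baseChange_ad A (A.symm Y) Z
  rw [← h1] at h2
  rw [← h2, hZ ⟨A.symm Y, hA Y Y.2⟩, map_smul, hmu ⟨A.symm Y, hA Y Y.2⟩ Y h1]

lemma baseChange_apply_symm (A : L ≃ₗ⁅ℝ⁆ L) (Z : ℂ ⊗[ℝ] L) :
    (A : L →ₗ[ℝ] L).baseChange ℂ ((A.symm : L →ₗ[ℝ] L).baseChange ℂ Z) = Z := by
  induction Z with
  | zero => simp
  | tmul z Y => simp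
  | add a b ha hb => simp only [map_add, ha, hb]

namespace TriangularDecomposition

variable (D : TriangularDecomposition L)

/-- An automorphism `A` of `L` reverses the triangular decomposition: it preserves `t` and carries
every positive root to a negative one. -/
structure Reverses (A : L ≃ₗ⁅ℝ⁆ L) : Prop where
  map_t : ∀ X ∈ D.t, A X ∈ D.t
  symm_t : ∀ X ∈ D.t, A.symm X ∈ D.t
  neg : ∀ lam ∈ D.pos, ∃ mu ∈ D.pos, ∀ X Y : D.t, (Y : L) = A X → mu Y = -lam X

namespace Reverses

variable {D} {A : L ≃ₗ⁅ℝ⁆ L} (hA : D.Reverses A)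
include hA

lemma map_h {Z : ℂ ⊗[ℝ] L} (hZ : Z ∈ D.h) : (A : L →ₗ[ℝ] L).baseChange ℂ Z ∈ D.h := by
  rw [h, Submodule.baseChange_eq_span] at hZ
  refine Submodule.span_induction
    (p := fun Z _ => (A : L →ₗ[ℝ] L).baseChange ℂ Z ∈ D.h) ?_ ?_ ?_ ?_ hZ
  · rintro _ ⟨X, hX, rfl⟩
    exact Submodule.tmul_mem_baseChange_of_mem 1 (hA.map_t X hX)
  · simp
  · intro x y _ _ hx hy
    rw [map_add]; exact add_mem hx hy
  · intro c x _ hx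
    rw [map_smul]; exact Submodule.smul_mem _ _ hx

lemma map_nPos {Z : ℂ ⊗[ℝ] L} (hZ : Z ∈ D.nPos) :
    (A : L →ₗ[ℝ] L).baseChange ℂ Z ∈ D.nNeg := by
  have : D.nPos ≤ D.nNeg.comap ((A : L →ₗ[ℝ] L).baseChange ℂ) := by
    refine iSup₂_le fun lam hl W hW => ?_
    obtain ⟨mu, hmu, h⟩ := hA.neg lam hl
    refine (le_iSup₂_of_le mu hmu le_rfl : rootSpace D.t (-mu) ≤ D.nNeg) ?_
    exact baseChange_mem_rootSpace A hA.symm_t (fun X Y hXY => by simp [h X Y hXY]) hW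
  exact this hZ

lemma map_nNeg {Z : ℂ ⊗[ℝ] L} (hZ : Z ∈ D.nNeg) :
    (A : L →ₗ[ℝ] L).baseChange ℂ Z ∈ D.nPos := by
  have : D.nNeg ≤ D.nPos.comap ((A : L →ₗ[ℝ] L).baseChange ℂ) := by
    refine iSup₂_le fun lam hl W hW => ?_
    obtain ⟨mu, hmu, h⟩ := hA.neg lam hl
    refine (le_iSup₂_of_le mu hmu le_rfl : rootSpace D.t mu ≤ D.nPos) ?_
    exact baseChange_mem_rootSpace A hA.symm_t (fun X Y hXY => by simp [h X Y hXY]) hW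
  exact this hZ

lemma hilbert_baseChange (Z : ℂ ⊗[ℝ] L) :
    D.hilbert ((A : L →ₗ[ℝ] L).baseChange ℂ Z) =
      -(A : L →ₗ[ℝ] L).baseChange ℂ (D.hilbert Z) := by
  obtain ⟨a, ha, b, hb, c, hc, rfl⟩ := D.exists_components Z
  simp only [map_add, D.hilbert_of_mem_nPos hc, D.hilbert_of_mem_nNeg ha, D.hilbert_of_mem_h hb,
    D.hilbert_of_mem_nPos (hA.map_nNeg ha), D.hilbert_of_mem_nNeg (hA.map_nPos hc),
    D.hilbert_of_mem_h (hA.map_h hb), map_neg, map_smul, map_zero]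
  abel

lemma hilbertReal_apply (X : L) : D.hilbertReal (A X) = -A (D.hilbertReal X) := by
  have h0 : ∀ Y : L, incl L (A Y) = (A : L →ₗ[ℝ] L).baseChange ℂ (incl L Y) := fun Y => by
    simp [incl_apply]
  apply incl_injective
  rw [D.incl_hilbertReal, h0, hA.hilbert_baseChange, map_neg, h0, D.incl_hilbertReal]

/-- The two nilpotent subalgebras are exchanged onto, because `A` is onto and preserves the sum
`n⁻ ⊕ h ⊕ n⁺` up to the exchange. -/
lemma image_nPos : (A : L →ₗ[ℝ] L).baseChange ℂ '' D.nPos = D.nNeg := by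
  refine Set.Subset.antisymm (by rintro _ ⟨Z, hZ, rfl⟩; exact hA.map_nPos hZ) fun Y hY => ?_
  let B := (A : L →ₗ[ℝ] L).baseChange ℂ
  obtain ⟨a, ha, b, hb, c, hc, habc⟩ := D.exists_components ((A.symm : L →ₗ[ℝ] L).baseChange ℂ Y)
  have h1 : B a + B b + B c = Y := by rw [← map_add, ← map_add, habc, baseChange_apply_symm]
  have h2 : Y - B c = B b + B a := by rw [← h1]; abel
  have h3 : Y - B c = 0 := Submodule.disjoint_def.1 D.isCompl_neg.disjoint _
    (sub_mem hY (hA.map_nPos hc))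
    (h2 ▸ add_mem (Submodule.mem_sup_left (hA.map_h hb)) (Submodule.mem_sup_right (hA.map_nNeg ha)))
  exact ⟨c, hc, (sub_eq_zero.1 h3).symm⟩

lemma image_nNeg : (A : L →ₗ[ℝ] L).baseChange ℂ '' D.nNeg = D.nPos := by
  refine Set.Subset.antisymm (by rintro _ ⟨Z, hZ, rfl⟩; exact hA.map_nNeg hZ) fun Y hY => ?_
  let B := (A : L →ₗ[ℝ] L).baseChange ℂ
  obtain ⟨a, ha, b, hb, c, hc, habc⟩ := D.exists_components ((A.symm : L →ₗ[ℝ] L).baseChange ℂ Y)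
  have h1 : B a + B b + B c = Y := by rw [← map_add, ← map_add, habc, baseChange_apply_symm]
  have h2 : Y - B a = B b + B c := by rw [← h1]; abel
  have h3 : Y - B a = 0 := Submodule.disjoint_def.1 D.isCompl_pos.disjoint _
    (sub_mem hY (hA.map_nNeg ha))
    (h2 ▸ add_mem (Submodule.mem_sup_left (hA.map_h hb)) (Submodule.mem_sup_right (hA.map_nPos hc)))
  exact ⟨a, ha, (sub_eq_zero.1 h3).symm⟩

end Reverses

end TriangularDecomposition

/-- The identification `L* ≃ L` is equivariant under automorphisms. -/
lemma killingSharp_comp (A : L ≃ₗ⁅ℝ⁆ L) (φ : Module.Dual ℝ L) :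
    A (killingSharp (φ ∘ₗ (A : L →ₗ[ℝ] L))) = killingSharp φ := by
  classical
  by_cases hb : Function.Bijective (killingForm ℝ L)
  · have hs : ∀ ψ : Module.Dual ℝ L, killingForm ℝ L (killingSharp ψ) = ψ := fun ψ => by
      simp only [killingSharp, dif_pos hb]
      exact (LinearEquiv.ofBijective (killingForm ℝ L) hb).apply_symm_apply ψ
    apply hb.1
    rw [hs]
    ext X
    have h1 := LieAlgebra.killingForm_of_equiv_apply A
      (killingSharp (φ ∘ₗ (A : L →ₗ[ℝ] L))) (A.symm X)
    rw [A.apply_symm_apply, hs] at h1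
    rw [h1]
    simp
  -- for a degenerate Killing form `killingSharp` is zero by definition
  · simp [killingSharp, dif_neg hb]

/-- An automorphism that reverses the triangular decomposition reverses the Hilbert transform,
seen as a bivector. -/
lemma TriangularDecomposition.Reverses.push_hilbertBivector [FiniteDimensional ℝ L]
    {D : TriangularDecomposition L} {A : L ≃ₗ⁅ℝ⁆ L} (hA : D.Reverses A) :
    Bivector.push (A : L →ₗ[ℝ] L) D.hilbertBivector = -D.hilbertBivector := by
  ext v
  change killingForm ℝ L (D.hilbertReal (killingSharp (v 0 ∘ₗ (A : L →ₗ[ℝ] L))))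
      (killingSharp (v 1 ∘ₗ (A : L →ₗ[ℝ] L))) =
    -killingForm ℝ L (D.hilbertReal (killingSharp (v 0))) (killingSharp (v 1))
  rw [← killingSharp_comp A (v 0), ← killingSharp_comp A (v 1), hA.hilbertReal_apply, map_neg,
    LinearMap.neg_apply, neg_neg, LieAlgebra.killingForm_of_equiv_apply]

end Algebra

/-! ### Second derivatives of a local group law -/

section Calculus
open Filter Topology

variable {E : Type*} [NormedAddCommGroup E] [NormedSpace ℝ E]

/-- The derivative at the unit of the adjoint action, in terms of the second derivatives of a local
multiplication `M` on a normed space with unit `e`: if `c (x, y)` is the conjugate of `y` by `x`,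
i.e. `M (c (x, y), x) = M (x, y)`, then the mixed second derivative of `c` is the antisymmetrized
mixed second derivative of `M`. -/
lemma fderiv_fderiv_conj {M c : E × E → E} {e : E} (hM : ContDiffAt ℝ 2 M (e, e))
    (hc : ContDiffAt ℝ 2 c (e, e)) (hMr : ∀ᶠ x in 𝓝 e, M (x, e) = x)
    (hcr : ∀ᶠ x in 𝓝 e, c (x, e) = e)
    (hcl : ∀ᶠ y in 𝓝 e, c (e, y) = y) (h : ∀ᶠ p in 𝓝 (e, e), M (c p, p.1) = M p) (X Y : E) :
    fderiv ℝ (fderiv ℝ c) (e, e) (X, 0) (0, Y) =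
      fderiv ℝ (fderiv ℝ M) (e, e) (X, 0) (0, Y) - fderiv ℝ (fderiv ℝ M) (e, e) (Y, 0) (0, X) := by
  have hM1 : ∀ᶠ p in 𝓝 (e, e), DifferentiableAt ℝ M p :=
    (hM.eventually (by simp)).mono fun p hp => hp.differentiableAt (by simp)
  have hc1 : ∀ᶠ p in 𝓝 (e, e), DifferentiableAt ℝ c p :=
    (hc.eventually (by simp)).mono fun p hp => hp.differentiableAt (by simp)
  have hM2 : DifferentiableAt ℝ (fderiv ℝ M) (e, e) :=
    (hM.fderiv_right (m := 1) (by norm_num)).differentiableAt (by simp)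
  have hc2 : DifferentiableAt ℝ (fderiv ℝ c) (e, e) :=
    (hc.fderiv_right (m := 1) (by norm_num)).differentiableAt (by simp)
  have tl : Tendsto (fun x : E => (x, e)) (𝓝 e) (𝓝 (e, e)) :=
    (continuous_id.prodMk continuous_const).tendsto' _ _ rfl
  have tr : Tendsto (fun x : E => (e, x)) (𝓝 e) (𝓝 (e, e)) :=
    (continuous_const.prodMk continuous_id).tendsto' _ _ rfl
  have dl : ∀ x : E, HasFDerivAt (fun x : E => (x, e)) (ContinuousLinearMap.inl ℝ E E) x := fun x =>
    (hasFDerivAt_id x).prodMk (hasFDerivAt_const e x)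
  have dr : ∀ x : E, HasFDerivAt (fun x : E => (e, x)) (ContinuousLinearMap.inr ℝ E E) x := fun x =>
    (hasFDerivAt_const e x).prodMk (hasFDerivAt_id x)
  -- first derivatives at the unit
  have hM_left : ∀ V : E, fderiv ℝ M (e, e) (V, 0) = V := fun V => by
    have h1 := (HasFDerivAt.comp e (f := fun x : E => (x, e)) hM1.self_of_nhds.hasFDerivAt
      (dl e)).unique ((hasFDerivAt_id e).congr_of_eventuallyEq hMr)
    simpa using congrArg (fun T => T V) h1
  have hc_right : fderiv ℝ c (e, e) (0, Y) = Y := by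
    have h1 := (HasFDerivAt.comp e (f := fun x : E => (e, x)) hc1.self_of_nhds.hasFDerivAt
      (dr e)).unique ((hasFDerivAt_id e).congr_of_eventuallyEq hcl)
    simpa using congrArg (fun T => T Y) h1
  -- the first-order identity, at all points `(x, e)` near the unit
  have key : ∀ᶠ x in 𝓝 e, fderiv ℝ M (e, x) (fderiv ℝ c (x, e) (0, Y), 0) =
      fderiv ℝ M (x, e) (0, Y) := by
    filter_upwards [tl.eventually hc1, tr.eventually hM1, tl.eventually h.eventually_nhds, hcr]
      with x h1 h2 h3 h4
    have h2' : HasFDerivAt M (fderiv ℝ M (e, x)) (c (x, e), x) := by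
      rw [h4]; exact h2.hasFDerivAt
    have h5 : HasFDerivAt (fun p : E × E => M (c p, p.1))
        ((fderiv ℝ M (e, x)).comp ((fderiv ℝ c (x, e)).prod (ContinuousLinearMap.fst ℝ E E)))
        (x, e) :=
      HasFDerivAt.comp (x, e) (f := fun p : E × E => (c p, p.1)) h2'
        (h1.hasFDerivAt.prodMk hasFDerivAt_fst)
    have h6 := (h5.congr_of_eventuallyEq (EventuallyEq.symm h3)).fderiv
    rw [h6]
    simp
  -- its derivative in the direction `X`
  have hA : HasFDerivAt (fun x : E => ((fderiv ℝ c (x, e) (0, Y), 0) : E × E))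
      ((ContinuousLinearMap.inl ℝ E E).comp
        (((fderiv ℝ (fderiv ℝ c) (e, e)).comp (ContinuousLinearMap.inl ℝ E E)).flip (0, Y))) e := by
    have h1 := HasFDerivAt.comp e (f := fun x : E => (x, e)) hc2.hasFDerivAt (dl e)
    have h2 := h1.clm_apply (hasFDerivAt_const ((0, Y) : E × E) e)
    have h3 := (h2.prodMk (hasFDerivAt_const (0 : E) e))
    refine h3.congr_fderiv ?_
    ext V <;> simp
  have hL := (HasFDerivAt.comp e (f := fun x : E => (e, x)) hM2.hasFDerivAt (dr e)).clm_apply hA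
  have hR := (HasFDerivAt.comp e (f := fun x : E => (x, e)) hM2.hasFDerivAt (dl e)).clm_apply
    (hasFDerivAt_const ((0, Y) : E × E) e)
  have h7 := congrArg (fun T => T X) (hL.unique (hR.congr_of_eventuallyEq key))
  have hsymm := hM.isSymmSndFDerivAt (by simp) (0, X) (Y, 0)
  simp only [Function.comp_apply, hc_right, add_apply,
    ContinuousLinearMap.comp_apply, ContinuousLinearMap.flip_apply, ContinuousLinearMap.inl_apply,
    ContinuousLinearMap.inr_apply, hM_left, hsymm, zero_apply, map_zero,
    zero_add] at h7
  exact eq_sub_of_add_eq h7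
end Calculus

/-! ### The Lie bracket in the chart at the unit -/

section LocalGroup
open Filter Topology VectorField

variable {E : Type*} [NormedAddCommGroup E] [NormedSpace ℝ E]
  {K : Type*} [TopologicalSpace K] [ChartedSpace E K] [Group K]

variable (E K) in
/-- The chart at the unit. -/
abbrev unitChart : PartialEquiv K E := extChartAt 𝓘(ℝ, E) (1 : K)

variable (E K) in
/-- The multiplication of `K`, read in the chart at the unit. -/
def localMul (p : E × E) : E :=
  unitChart E K ((unitChart E K).symm p.1 * (unitChart E K).symm p.2)

variable (E K) in
/-- The conjugation `(k, g) ↦ k g k⁻¹` of `K`, read in the chart at the unit. -/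
def localConj (p : E × E) : E :=
  unitChart E K ((unitChart E K).symm p.1 * (unitChart E K).symm p.2 *
    ((unitChart E K).symm p.1)⁻¹)

lemma unitChart_symm_one : (unitChart E K).symm (unitChart E K 1) = 1 :=
  (unitChart E K).left_inv (mem_extChartAt_source _)

/-- The derivative at the unit of a vector-valued map is its derivative in the chart. -/
lemma mfderiv_one_eq_fderiv {F : Type*} [NormedAddCommGroup F] [NormedSpace ℝ F] {f : K → F}
    (hf : MDifferentiableAt 𝓘(ℝ, E) 𝓘(ℝ, F) f 1) :
    (mfderiv 𝓘(ℝ, E) 𝓘(ℝ, F) f 1 : E →L[ℝ] F) =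
      fderiv ℝ (f ∘ (unitChart E K).symm) (unitChart E K 1) := by
  let T : E →L[ℝ] F := mfderiv 𝓘(ℝ, E) 𝓘(ℝ, F) f 1
  have h1 : HasFDerivWithinAt (f ∘ (unitChart E K).symm) T (Set.range 𝓘(ℝ, E)) (unitChart E K 1) :=
    hf.hasMFDerivAt.2
  exact (h1.hasFDerivAt (by simp)).fderiv.symm

variable [LieGroup 𝓘(ℝ, E) ∞ K]

instance : IsManifold 𝓘(ℝ, E) ∞ K := LieGroup.toContMDiffMul.toIsManifold

lemma mfderiv_unitChart_one :
    (mfderiv 𝓘(ℝ, E) 𝓘(ℝ, E) (unitChart E K) (1 : K) : E →L[ℝ] E) = ContinuousLinearMap.id ℝ E :=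
  mfderiv_extChartAt_self (I := 𝓘(ℝ, E)) (x := (1 : K))

/-- The chart derivative of a map between neighbourhoods of the unit. -/
lemma mfderiv_unitChart_mfderiv {f : K → K} (hf : MDifferentiableAt 𝓘(ℝ, E) 𝓘(ℝ, E) f 1)
    (h1 : f 1 ∈ (unitChart E K).source) :
    (mfderiv 𝓘(ℝ, E) 𝓘(ℝ, E) (unitChart E K) (f 1) : E →L[ℝ] E).comp
      (mfderiv 𝓘(ℝ, E) 𝓘(ℝ, E) f 1 : E →L[ℝ] E) =
      fderiv ℝ (unitChart E K ∘ f ∘ (unitChart E K).symm) (unitChart E K 1) := by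
  have h2 : MDifferentiableAt 𝓘(ℝ, E) 𝓘(ℝ, E) (unitChart E K) (f 1) :=
    mdifferentiableAt_extChartAt (by rwa [extChartAt_source] at h1)
  have h3 := mfderiv_one_eq_fderiv (f := unitChart E K ∘ f) (h2.comp 1 hf)
  rw [mfderiv_comp 1 h2 hf] at h3
  exact h3

omit [LieGroup 𝓘(ℝ, E) ∞ K] in
lemma contMDiffAt_unitChart_symm :
    ContMDiffAt 𝓘(ℝ, E) 𝓘(ℝ, E) ∞ (unitChart E K).symm (unitChart E K (1 : K)) := by
  have := contMDiffWithinAt_extChartAt_symm_range_self (I := 𝓘(ℝ, E)) (n := ∞) (1 : K)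
  simpa [contMDiffWithinAt_univ] using this

omit [LieGroup 𝓘(ℝ, E) ∞ K] in
lemma contDiffAt_chart_comp {F : Type*} [NormedAddCommGroup F] [NormedSpace ℝ F] {f : F → K} {x : F}
    (hf : ContMDiffAt 𝓘(ℝ, F) 𝓘(ℝ, E) ∞ f x) (h1 : f x = 1) :
    ContDiffAt ℝ ∞ (unitChart E K ∘ f) x := by
  rw [← contMDiffAt_iff_contDiffAt]
  refine ContMDiffAt.comp x ?_ hf
  rw [h1]
  exact contMDiffAt_extChartAt

omit [LieGroup 𝓘(ℝ, E) ∞ K] in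
lemma contMDiffAt_symm_fst :
    ContMDiffAt 𝓘(ℝ, E × E) 𝓘(ℝ, E) ∞ (fun p : E × E => (unitChart E K).symm p.1)
      (unitChart E K (1 : K), unitChart E K (1 : K)) :=
  ContMDiffAt.comp _ (contMDiffAt_unitChart_symm (E := E) (K := K))
    contDiff_fst.contMDiff.contMDiffAt

omit [LieGroup 𝓘(ℝ, E) ∞ K] in
lemma contMDiffAt_symm_snd :
    ContMDiffAt 𝓘(ℝ, E × E) 𝓘(ℝ, E) ∞ (fun p : E × E => (unitChart E K).symm p.2)
      (unitChart E K (1 : K), unitChart E K (1 : K)) :=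
  ContMDiffAt.comp _ (contMDiffAt_unitChart_symm (E := E) (K := K))
    contDiff_snd.contMDiff.contMDiffAt

lemma contDiffAt_localMul :
    ContDiffAt ℝ ∞ (localMul E K) (unitChart E K (1 : K), unitChart E K (1 : K)) :=
  contDiffAt_chart_comp (contMDiffAt_symm_fst.mul contMDiffAt_symm_snd)
    (by simp only [unitChart_symm_one, mul_one])

lemma contDiffAt_localConj :
    ContDiffAt ℝ ∞ (localConj E K) (unitChart E K (1 : K), unitChart E K (1 : K)) :=
  contDiffAt_chart_comp ((contMDiffAt_symm_fst.mul contMDiffAt_symm_snd).mul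
    contMDiffAt_symm_fst.inv)
    (by simp only [unitChart_symm_one, mul_one, inv_one])

omit [LieGroup 𝓘(ℝ, E) ∞ K] in
lemma eventually_mem_unitChart_target :
    ∀ᶠ x in 𝓝 (unitChart E K (1 : K)), x ∈ (unitChart E K).target := by
  have := extChartAt_target_mem_nhds (I := 𝓘(ℝ, E)) (1 : K)
  exact this

lemma mdifferentiableAt_mul_left (k g : K) :
    MDifferentiableAt 𝓘(ℝ, E) 𝓘(ℝ, E) (fun g : K => k * g) g :=
  (contMDiff_mul_left (I := 𝓘(ℝ, E)) (n := ∞)).contMDiffAt.mdifferentiableAt (by simp)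

lemma mdifferentiableAt_mul_right (k g : K) :
    MDifferentiableAt 𝓘(ℝ, E) 𝓘(ℝ, E) (fun g : K => g * k) g :=
  (contMDiff_mul_right (I := 𝓘(ℝ, E)) (n := ∞)).contMDiffAt.mdifferentiableAt (by simp)

variable (E) in
lemma contMDiff_conj (k : K) : ContMDiff 𝓘(ℝ, E) 𝓘(ℝ, E) ∞ (fun g : K => k * g * k⁻¹) :=
  (contMDiff_const.mul contMDiff_id).mul contMDiff_const

lemma mdifferentiableAt_conj (k g : K) :
    MDifferentiableAt 𝓘(ℝ, E) 𝓘(ℝ, E) (fun g : K => k * g * k⁻¹) g :=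
  (contMDiff_conj E k).contMDiffAt.mdifferentiableAt (by simp)

lemma eventually_differentiableAt_localMul :
    ∀ᶠ x in 𝓝 (unitChart E K (1 : K)),
      DifferentiableAt ℝ (localMul E K) (x, unitChart E K (1 : K)) := by
  have tl : Tendsto (fun x : E => (x, unitChart E K (1 : K))) (𝓝 (unitChart E K (1 : K)))
      (𝓝 (unitChart E K (1 : K), unitChart E K (1 : K))) :=
    (continuous_id.prodMk continuous_const).tendsto' _ _ rfl
  refine tl.eventually ?_
  exact ((contDiffAt_localMul.of_le (m := 1) (by simp)).eventually (by simp)).mono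
    fun p hp => hp.differentiableAt (by simp)

/-- Near the unit, left-invariant vector fields are derivatives of the local multiplication. -/
lemma mfderiv_unitChart_mulInvariantVectorField (X : GroupLieAlgebra 𝓘(ℝ, E) K) :
    ∀ᶠ x in 𝓝 (unitChart E K (1 : K)),
      (mfderiv 𝓘(ℝ, E) 𝓘(ℝ, E) (unitChart E K) ((unitChart E K).symm x) : E →L[ℝ] E)
        (mulInvariantVectorField X ((unitChart E K).symm x)) =
      fderiv ℝ (localMul E K) (x, unitChart E K (1 : K)) ((0, X) : E × E) := by
  filter_upwards [eventually_mem_unitChart_target, eventually_differentiableAt_localMul (K := K)]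
    with x hx hdx
  have hs : (unitChart E K).symm x * 1 ∈ (unitChart E K).source := by
    rw [mul_one]; exact (unitChart E K).map_target hx
  have h2 := mfderiv_unitChart_mfderiv
    (mdifferentiableAt_mul_left (E := E) ((unitChart E K).symm x) 1) hs
  have h4 : HasFDerivAt (unitChart E K ∘ (fun g : K => (unitChart E K).symm x * g) ∘
      (unitChart E K).symm) ((fderiv ℝ (localMul E K) (x, unitChart E K (1 : K))).comp
        (ContinuousLinearMap.inr ℝ E E)) (unitChart E K (1 : K)) :=
    HasFDerivAt.comp (unitChart E K (1 : K)) (f := fun y : E => (x, y)) hdx.hasFDerivAt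
      ((hasFDerivAt_const x _).prodMk (hasFDerivAt_id _))
  have h5 : ∀ g : K, g = (unitChart E K).symm x →
      (mfderiv 𝓘(ℝ, E) 𝓘(ℝ, E) (unitChart E K) g : E →L[ℝ] E) =
        mfderiv 𝓘(ℝ, E) 𝓘(ℝ, E) (unitChart E K) ((unitChart E K).symm x) := by
    rintro _ rfl; rfl
  rw [h5 _ (mul_one _), h4.fderiv] at h2
  exact congrArg (fun T : E →L[ℝ] E => T X) h2

lemma mpullbackWithin_mulInvariantVectorField (X : GroupLieAlgebra 𝓘(ℝ, E) K) :
    ∀ᶠ x in 𝓝 (unitChart E K (1 : K)),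
      (mpullbackWithin 𝓘(ℝ, E) 𝓘(ℝ, E) (unitChart E K).symm (mulInvariantVectorField X)
        (Set.range 𝓘(ℝ, E)) x : E) =
      fderiv ℝ (localMul E K) (x, unitChart E K (1 : K)) ((0, X) : E × E) := by
  filter_upwards [eventually_mem_unitChart_target, mfderiv_unitChart_mulInvariantVectorField X]
    with x hx hX
  have h1 : (mfderivWithin 𝓘(ℝ, E) 𝓘(ℝ, E) (unitChart E K).symm (Set.range 𝓘(ℝ, E)) x).inverse =
      mfderiv 𝓘(ℝ, E) 𝓘(ℝ, E) (unitChart E K) ((unitChart E K).symm x) :=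
    ContinuousLinearMap.inverse_eq (mfderivWithin_extChartAt_symm_comp_mfderiv_extChartAt hx)
      (mfderiv_extChartAt_comp_mfderivWithin_extChartAt_symm hx)
  rw [mpullbackWithin_apply, h1]
  exact hX

/-- The Lie bracket in terms of the local multiplication. -/
lemma lie_eq_fderiv_localMul [CompleteSpace E] (X Y : GroupLieAlgebra 𝓘(ℝ, E) K) :
    (⁅X, Y⁆ : GroupLieAlgebra 𝓘(ℝ, E) K) =
      (fderiv ℝ (fderiv ℝ (localMul E K)) (unitChart E K (1 : K), unitChart E K (1 : K))
        ((X, 0) : E × E) ((0, Y) : E × E) -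
      fderiv ℝ (fderiv ℝ (localMul E K)) (unitChart E K (1 : K), unitChart E K (1 : K))
        ((Y, 0) : E × E) ((0, X) : E × E) : E) := by
  set e := unitChart E K (1 : K) with he
  have hM2 : DifferentiableAt ℝ (fderiv ℝ (localMul E K)) (e, e) :=
    ((contDiffAt_localMul.of_le (m := 2) (WithTop.coe_le_coe.2 le_top)).fderiv_right (m := 1)
      (by norm_num)).differentiableAt (by simp)
  have hM1 : DifferentiableAt ℝ (localMul E K) (e, e) :=
    contDiffAt_localMul.differentiableAt (by simp)
  have hfd : ∀ Z : E, HasFDerivAt (fun x => fderiv ℝ (localMul E K) (x, e) ((0, Z) : E × E))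
      (((fderiv ℝ (fderiv ℝ (localMul E K)) (e, e)).comp
        (ContinuousLinearMap.inl ℝ E E)).flip (0, Z)) e := fun Z => by
    have h1 := HasFDerivAt.comp e (f := fun x : E => (x, e)) hM2.hasFDerivAt
      ((hasFDerivAt_id e).prodMk (hasFDerivAt_const e e))
    have h2 := h1.clm_apply (hasFDerivAt_const ((0, Z) : E × E) e)
    refine h2.congr_fderiv ?_
    ext V; simp
  have hval : ∀ Z : E, fderiv ℝ (localMul E K) (e, e) ((0, Z) : E × E) = Z := fun Z => by
    have h1 := HasFDerivAt.comp e (f := fun x : E => (e, x)) hM1.hasFDerivAt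
      ((hasFDerivAt_const e e).prodMk (hasFDerivAt_id e))
    have h2 : (localMul E K ∘ fun x => (e, x)) =ᶠ[𝓝 e] id := by
      filter_upwards [eventually_mem_unitChart_target] with x hx
      simp only [localMul, Function.comp_apply, he, unitChart_symm_one, one_mul, id]
      exact (unitChart E K).right_inv hx
    have h3 := h1.unique ((hasFDerivAt_id e).congr_of_eventuallyEq h2)
    simpa using congrArg (fun T => T Z) h3
  have hX := mpullbackWithin_mulInvariantVectorField X
  have hY := mpullbackWithin_mulInvariantVectorField Y
  have hid : ((mfderiv 𝓘(ℝ, E) 𝓘(ℝ, E) (unitChart E K) (1 : K)).inverse : E →L[ℝ] E) =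
      ContinuousLinearMap.id ℝ E :=
    (congrArg (fun T : E →L[ℝ] E => T.inverse) mfderiv_unitChart_one).trans
      ContinuousLinearMap.inverse_id
  let V : E → E := fun x => mpullbackWithin 𝓘(ℝ, E) 𝓘(ℝ, E) (unitChart E K).symm
    (mulInvariantVectorField X) (Set.range 𝓘(ℝ, E)) x
  let W : E → E := fun x => mpullbackWithin 𝓘(ℝ, E) 𝓘(ℝ, E) (unitChart E K).symm
    (mulInvariantVectorField Y) (Set.range 𝓘(ℝ, E)) x
  have h1 : lieBracketWithin ℝ V W
      ((unitChart E K).symm ⁻¹' Set.univ ∩ Set.range 𝓘(ℝ, E)) e = lieBracket ℝ V W e := by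
    simp only [Set.preimage_univ, Set.univ_inter, modelWithCornersSelf_coe, Set.range_id,
      lieBracketWithin_univ]
  have h2 := (Filter.EventuallyEq.lieBracket_vectorField_eq (𝕜 := ℝ) (x := e) (V₁ := V) (W₁ := W)
    hX hY)
  have h3 : ∀ X Y : E, lieBracket ℝ (fun x => fderiv ℝ (localMul E K) (x, e) ((0, X) : E × E))
      (fun x => fderiv ℝ (localMul E K) (x, e) ((0, Y) : E × E)) e =
      fderiv ℝ (fderiv ℝ (localMul E K)) (e, e) ((X, 0) : E × E) ((0, Y) : E × E) -
      fderiv ℝ (fderiv ℝ (localMul E K)) (e, e) ((Y, 0) : E × E) ((0, X) : E × E) := fun X Y => by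
    rw [lieBracket_eq]
    simp only [(hfd _).fderiv, hval, ContinuousLinearMap.flip_apply,
      ContinuousLinearMap.comp_apply, ContinuousLinearMap.inl_apply]
  exact ((congrArg (fun T : E →L[ℝ] E => T (lieBracketWithin ℝ V W
      ((unitChart E K).symm ⁻¹' Set.univ ∩ Set.range 𝓘(ℝ, E)) e)) hid).trans
      (h1.trans h2)).trans (h3 X Y)

end LocalGroup

/-! ### One-parameter subgroups and the derivative of the adjoint action -/

section ChainRule

variable {E E' E'' : Type*} [NormedAddCommGroup E] [NormedSpace ℝ E] [NormedAddCommGroup E']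
  [NormedSpace ℝ E'] [NormedAddCommGroup E''] [NormedSpace ℝ E'']
  {M M' M'' : Type*} [TopologicalSpace M] [ChartedSpace E M] [TopologicalSpace M']
  [ChartedSpace E' M'] [TopologicalSpace M''] [ChartedSpace E'' M'']

/-- The chain rule, with derivatives seen as maps of the model spaces. This allows the point `f x`
to be replaced by an equal one. -/
lemma mfderiv_comp_model {g : M' → M''} {f : M → M'} {x : M} {y : M'} (hxy : f x = y)
    (hg : MDifferentiableAt 𝓘(ℝ, E') 𝓘(ℝ, E'') g y)
    (hf : MDifferentiableAt 𝓘(ℝ, E) 𝓘(ℝ, E') f x) :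
    (mfderiv 𝓘(ℝ, E) 𝓘(ℝ, E'') (fun x => g (f x)) x : E →L[ℝ] E'') =
      (mfderiv 𝓘(ℝ, E') 𝓘(ℝ, E'') g y : E' →L[ℝ] E'').comp
        (mfderiv 𝓘(ℝ, E) 𝓘(ℝ, E') f x : E →L[ℝ] E') := by
  subst hxy
  exact mfderiv_comp x hg hf

lemma mfderiv_comp_model_apply {g : M' → M''} {f : M → M'} {x : M} {y : M'} (hxy : f x = y)
    (hg : MDifferentiableAt 𝓘(ℝ, E') 𝓘(ℝ, E'') g y)
    (hf : MDifferentiableAt 𝓘(ℝ, E) 𝓘(ℝ, E') f x) (v : E) :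
    (mfderiv 𝓘(ℝ, E) 𝓘(ℝ, E'') (fun x => g (f x)) x : E →L[ℝ] E'') v =
      (mfderiv 𝓘(ℝ, E') 𝓘(ℝ, E'') g y : E' →L[ℝ] E'')
        ((mfderiv 𝓘(ℝ, E) 𝓘(ℝ, E') f x : E →L[ℝ] E') v) :=
  congrArg (fun T : E →L[ℝ] E'' => T v) (mfderiv_comp_model hxy hg hf)

end ChainRule

section Adjoint
open Filter Topology

variable {E : Type*} [NormedAddCommGroup E] [NormedSpace ℝ E]
  {K : Type*} [TopologicalSpace K] [ChartedSpace E K] [Group K]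

/-- `γ` is a smooth one-parameter subgroup with initial velocity `X`. -/
structure IsOneParam (γ : ℝ → K) (X : GroupLieAlgebra 𝓘(ℝ, E) K) : Prop where
  smooth : ContMDiff 𝓘(ℝ, ℝ) 𝓘(ℝ, E) ∞ γ
  add : ∀ a b, γ (a + b) = γ a * γ b
  deriv : (mfderiv 𝓘(ℝ, ℝ) 𝓘(ℝ, E) γ 0 (1 : ℝ) : E) = X

lemma mem_expSet {S : Set (GroupLieAlgebra 𝓘(ℝ, E) K)} {g : K} :
    g ∈ expSet S ↔ ∃ γ : ℝ → K, ∃ X ∈ S, IsOneParam γ X ∧ γ 1 = g := by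
  constructor
  · rintro ⟨γ, h1, h2, h3, h4⟩
    exact ⟨γ, _, h3, ⟨h1, h2, rfl⟩, h4⟩
  · rintro ⟨γ, X, hX, h, h4⟩
    exact ⟨γ, h.smooth, h.add, h.deriv ▸ hX, h4⟩

lemma IsOneParam.zero {γ : ℝ → K} {X : GroupLieAlgebra 𝓘(ℝ, E) K} (h : IsOneParam γ X) :
    γ 0 = 1 := by
  have := h.add 0 0
  rwa [add_zero, left_eq_mul] at this

lemma IsOneParam.mdifferentiableAt {γ : ℝ → K} {X : GroupLieAlgebra 𝓘(ℝ, E) K}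
    (h : IsOneParam γ X) (s : ℝ) : MDifferentiableAt 𝓘(ℝ, ℝ) 𝓘(ℝ, E) γ s :=
  h.smooth.contMDiffAt.mdifferentiableAt (by simp)

variable (E) in
/-- `Ad k` as a continuous linear map of the model space. -/
def AdE (k : K) : E →L[ℝ] E := mfderiv 𝓘(ℝ, E) 𝓘(ℝ, E) (fun g : K => k * g * k⁻¹) 1

variable [LieGroup 𝓘(ℝ, E) ∞ K]

lemma Ad_mul (k k' : K) (X : GroupLieAlgebra 𝓘(ℝ, E) K) : Ad (k * k') X = Ad k (Ad k' X) := by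
  have h := mfderiv_comp_model_apply (E := E) (E' := E) (E'' := E) (x := (1 : K)) (y := (1 : K))
    (g := fun g : K => k * g * k⁻¹) (f := fun g : K => k' * g * k'⁻¹) (by simp)
    (mdifferentiableAt_conj k 1) (mdifferentiableAt_conj k' 1) X
  have h2 : (fun g : K => k * (k' * g * k'⁻¹) * k⁻¹) = fun g => (k * k') * g * (k * k')⁻¹ := by
    ext g; group
  rw [h2] at h
  exact h

omit [LieGroup 𝓘(ℝ, E) ∞ K] in
lemma Ad_one (X : GroupLieAlgebra 𝓘(ℝ, E) K) : Ad (1 : K) X = X := by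
  have h2 : (fun g : K => (1 : K) * g * 1⁻¹) = id := by
    ext g; simp
  have h3 : (Ad (1 : K) X : E) = (mfderiv 𝓘(ℝ, E) 𝓘(ℝ, E) (fun g : K => (1 : K) * g * 1⁻¹) 1 :
    E →L[ℝ] E) X := rfl
  rw [h2] at h3
  refine h3.trans ?_
  exact congrArg (fun T : E →L[ℝ] E => T X) (mfderiv_id (I := 𝓘(ℝ, E)) (x := (1 : K)))

lemma Ad_inv_apply (k : K) (X : GroupLieAlgebra 𝓘(ℝ, E) K) : Ad k⁻¹ (Ad k X) = X := by
  rw [← Ad_mul, inv_mul_cancel, Ad_one]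

lemma Ad_apply_inv (k : K) (X : GroupLieAlgebra 𝓘(ℝ, E) K) : Ad k (Ad k⁻¹ X) = X := by
  rw [← Ad_mul, mul_inv_cancel, Ad_one]

/-- Conjugates of one-parameter subgroups. -/
lemma IsOneParam.conj {γ : ℝ → K} {X : GroupLieAlgebra 𝓘(ℝ, E) K} (h : IsOneParam γ X) (k : K) :
    IsOneParam (fun s => k * γ s * k⁻¹) (Ad k X) where
  smooth := (contMDiff_conj E k).comp h.smooth
  add a b := by rw [h.add]; group
  deriv := by
    have h1 := mfderiv_comp_model_apply (E := ℝ) (E' := E) (E'' := E) (x := (0 : ℝ)) (y := (1 : K))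
      (g := fun g : K => k * g * k⁻¹) (f := γ) h.zero (mdifferentiableAt_conj k 1)
      (h.mdifferentiableAt 0) 1
    refine h1.trans ?_
    exact congrArg (Ad k) h.deriv

lemma Ad_eq_fderiv (k : K) (Y : GroupLieAlgebra 𝓘(ℝ, E) K) :
    AdE E k Y = fderiv ℝ (unitChart E K ∘ (fun g => k * g * k⁻¹) ∘ (unitChart E K).symm)
      (unitChart E K (1 : K)) Y := by
  have h1 : k * 1 * k⁻¹ = 1 := by simp
  have h2 := mfderiv_unitChart_mfderiv (mdifferentiableAt_conj (E := E) k 1)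
    (by rw [h1]; exact mem_extChartAt_source _)
  have h5 : ∀ g : K, g = 1 →
      (mfderiv 𝓘(ℝ, E) 𝓘(ℝ, E) (unitChart E K) g : E →L[ℝ] E) = ContinuousLinearMap.id ℝ E := by
    rintro _ rfl; exact mfderiv_unitChart_one
  rw [h5 _ h1] at h2
  exact congrArg (fun T : E →L[ℝ] E => T Y) h2

/-- The differential of the adjoint action at the unit is the Lie bracket; version in the chart. -/
lemma hasFDerivAt_Ad_symm [CompleteSpace E] (Y : GroupLieAlgebra 𝓘(ℝ, E) K) :
    ∃ T : E →L[ℝ] E, HasFDerivAt (fun x : E => AdE E ((unitChart E K).symm x) Y) T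
      (unitChart E K (1 : K)) ∧
      ∀ X : GroupLieAlgebra 𝓘(ℝ, E) K, T X = (⁅X, Y⁆ : GroupLieAlgebra 𝓘(ℝ, E) K) := by
  set e := unitChart E K (1 : K) with he
  have tl : Tendsto (fun x : E => (x, e)) (𝓝 e) (𝓝 (e, e)) :=
    (continuous_id.prodMk continuous_const).tendsto' _ _ rfl
  have hM := (contDiffAt_localMul (E := E) (K := K)).of_le (m := 2) (WithTop.coe_le_coe.2 le_top)
  have hc := (contDiffAt_localConj (E := E) (K := K)).of_le (m := 2) (WithTop.coe_le_coe.2 le_top)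
  rw [← he] at hM hc
  have hc1 : ∀ᶠ p in 𝓝 (e, e), DifferentiableAt ℝ (localConj E K) p :=
    (hc.eventually (by simp)).mono fun p hp => hp.differentiableAt (by simp)
  have hc2 : DifferentiableAt ℝ (fderiv ℝ (localConj E K)) (e, e) :=
    (hc.fderiv_right (m := 1) (by norm_num)).differentiableAt (by simp)
  have hAd : (fun x : E => AdE E ((unitChart E K).symm x) Y) =ᶠ[𝓝 e]
      fun x => fderiv ℝ (localConj E K) (x, e) ((0, Y) : E × E) := by
    filter_upwards [tl.eventually hc1] with x hx
    have h4 : HasFDerivAt (unitChart E K ∘ (fun g : K => (unitChart E K).symm x * g *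
        ((unitChart E K).symm x)⁻¹) ∘ (unitChart E K).symm)
        ((fderiv ℝ (localConj E K) (x, e)).comp (ContinuousLinearMap.inr ℝ E E)) e :=
      HasFDerivAt.comp e (f := fun y : E => (x, y)) hx.hasFDerivAt
        ((hasFDerivAt_const x _).prodMk (hasFDerivAt_id _))
    have h5 := Ad_eq_fderiv ((unitChart E K).symm x) Y
    rw [h4.fderiv] at h5
    exact h5
  have h1 := HasFDerivAt.comp e (f := fun x : E => (x, e)) hc2.hasFDerivAt
    ((hasFDerivAt_id e).prodMk (hasFDerivAt_const e e))
  have h2 := h1.clm_apply (hasFDerivAt_const ((0, Y) : E × E) e)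
  refine ⟨_, h2.congr_of_eventuallyEq hAd, fun X => ?_⟩
  have ht := eventually_mem_unitChart_target (E := E) (K := K)
  -- near the unit, the chart and its inverse cancel on the product of two elements
  have hconj : ∀ᶠ p in 𝓝 (e, e),
      localMul E K (localConj E K p, p.1) = localMul E K p := by
    have hcont : ContinuousAt (fun p : E × E => (unitChart E K).symm p.1 * (unitChart E K).symm p.2
        * ((unitChart E K).symm p.1)⁻¹) (e, e) :=
      ((contMDiffAt_symm_fst (E := E) (K := K)).mul contMDiffAt_symm_snd).mul
        contMDiffAt_symm_fst.inv |>.continuousAt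
    have hone : (unitChart E K).symm (e, e).1 * (unitChart E K).symm (e, e).2
        * ((unitChart E K).symm (e, e).1)⁻¹ = 1 := by
      simp only [he, unitChart_symm_one, mul_one, inv_one]
    have hs : (unitChart E K).source ∈ 𝓝 ((unitChart E K).symm (e, e).1 *
        (unitChart E K).symm (e, e).2 * ((unitChart E K).symm (e, e).1)⁻¹) := by
      rw [hone]; exact extChartAt_source_mem_nhds (1 : K)
    filter_upwards [hcont.eventually hs] with p hp
    simp only [localMul, localConj]
    rw [(unitChart E K).left_inv hp]
    simp
  have h3 := fderiv_fderiv_conj hM hc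
    (by filter_upwards [ht] with x hx
        simp only [localMul, he, unitChart_symm_one, mul_one]
        exact (unitChart E K).right_inv hx)
    (by filter_upwards with x
        simp only [localConj, he, unitChart_symm_one, mul_one, mul_inv_cancel])
    (by filter_upwards [ht] with x hx
        simp only [localConj, he, unitChart_symm_one, one_mul, inv_one, mul_one]
        exact (unitChart E K).right_inv hx) hconj X Y
  refine Eq.trans ?_ (h3.trans (lie_eq_fderiv_localMul X Y).symm)
  simp
  rfl

/-- The derivative of the adjoint action along a curve through the unit is the Lie bracket with its
velocity. -/
lemma hasDerivAt_Ad [CompleteSpace E] {c : ℝ → K} {X : GroupLieAlgebra 𝓘(ℝ, E) K}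
    (hc : MDifferentiableAt 𝓘(ℝ, ℝ) 𝓘(ℝ, E) c 0) (h0 : c 0 = 1)
    (hX : (mfderiv 𝓘(ℝ, ℝ) 𝓘(ℝ, E) c 0 (1 : ℝ) : E) = X) (Y : GroupLieAlgebra 𝓘(ℝ, E) K) :
    HasDerivAt (fun s => AdE E (c s) Y) (⁅X, Y⁆ : GroupLieAlgebra 𝓘(ℝ, E) K) 0 := by
  have hφ : MDifferentiableAt 𝓘(ℝ, E) 𝓘(ℝ, E) (unitChart E K) (1 : K) :=
    mdifferentiableAt_extChartAt (mem_chart_source E 1)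
  have h1 : HasDerivAt (fun s => unitChart E K (c s)) X 0 := by
    have hd : MDifferentiableAt 𝓘(ℝ, ℝ) 𝓘(ℝ, E) (fun s => unitChart E K (c s)) 0 :=
      MDifferentiableAt.comp (0 : ℝ) (by rw [h0]; exact hφ) hc
    have hd2 : DifferentiableAt ℝ (fun s => unitChart E K (c s)) 0 :=
      mdifferentiableAt_iff_differentiableAt.1 hd
    have h2 := mfderiv_comp_model_apply (E := ℝ) (E' := E) (E'' := E) h0 hφ hc 1
    have h3 : fderiv ℝ (fun s => unitChart E K (c s)) 0 1 = X := by
      rw [← mfderiv_eq_fderiv]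
      refine h2.trans (Eq.trans ?_ hX)
      exact congrArg (fun T : E →L[ℝ] E => T _) mfderiv_unitChart_one
    have := hd2.hasDerivAt
    rwa [← fderiv_apply_one_eq_deriv, h3] at this
  obtain ⟨T, hT, hTX⟩ := hasFDerivAt_Ad_symm (E := E) (K := K) Y
  rw [← hTX X]
  have hT' : HasFDerivAt (fun x : E => AdE E ((unitChart E K).symm x) Y) T
      (unitChart E K (c 0)) := by rwa [h0]
  refine (hT'.comp_hasDerivAt 0 h1).congr_of_eventuallyEq ?_
  have hs : (unitChart E K).source ∈ 𝓝 (c 0) := by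
    rw [h0]; exact extChartAt_source_mem_nhds (1 : K)
  filter_upwards [hc.continuousAt.eventually hs] with s hs
  simp only [Function.comp_apply]
  rw [(unitChart E K).left_inv hs]

lemma IsOneParam.hasDerivAt_Ad [CompleteSpace E] {γ : ℝ → K} {X : GroupLieAlgebra 𝓘(ℝ, E) K}
    (h : IsOneParam γ X) (Y : GroupLieAlgebra 𝓘(ℝ, E) K) (s : ℝ) :
    HasDerivAt (fun s => AdE E (γ s) Y)
      (AdE E (γ s) (⁅X, Y⁆ : GroupLieAlgebra 𝓘(ℝ, E) K)) s := by
  have h1 := CompactPoisson.hasDerivAt_Ad (h.mdifferentiableAt 0) h.zero h.deriv Y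
  have h2 : HasDerivAt (fun u => AdE E (γ s) (AdE E (γ u) Y))
      (AdE E (γ s) (⁅X, Y⁆ : GroupLieAlgebra 𝓘(ℝ, E) K)) 0 :=
    (AdE E (γ s)).hasFDerivAt.comp_hasDerivAt 0 h1
  have h3 : HasDerivAt (fun u : ℝ => u - s) 1 s := (hasDerivAt_id s).sub_const s
  have h4 := HasDerivAt.scomp (g₁ := fun u => AdE E (γ s) (AdE E (γ u) Y)) s (by rwa [sub_self]) h3
  rw [one_smul] at h4
  refine h4.congr_of_eventuallyEq (Eventually.of_forall fun u => ?_)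
  have h5 : γ u = γ s * γ (u - s) := by rw [← h.add]; congr 1; ring
  simp only [Function.comp_apply]
  rw [h5]
  exact Ad_mul _ _ _

/-- The adjoint action is continuous. -/
lemma continuous_Ad [CompleteSpace E] (Y : GroupLieAlgebra 𝓘(ℝ, E) K) :
    Continuous (fun k : K => AdE E k Y) := by
  have : IsTopologicalGroup K := topologicalGroup_of_lieGroup 𝓘(ℝ, E) ∞
  rw [continuous_iff_continuousAt]
  intro k
  have h1 : ContinuousAt (fun g : K => AdE E g Y) 1 := by
    obtain ⟨T, hT, -⟩ := hasFDerivAt_Ad_symm (E := E) (K := K) Y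
    have h2 : ContinuousAt (fun g : K => AdE E ((unitChart E K).symm (unitChart E K g)) Y) 1 :=
      ContinuousAt.comp (f := unitChart E K) hT.continuousAt (continuousAt_extChartAt (1 : K))
    refine h2.congr ?_
    filter_upwards [extChartAt_source_mem_nhds (I := 𝓘(ℝ, E)) (1 : K)] with g hg
    rw [(unitChart E K).left_inv hg]
  have h2 : ContinuousAt (fun g : K => AdE E k (AdE E (k⁻¹ * g) Y)) k := by
    refine (AdE E k).continuous.continuousAt.comp ?_
    refine ContinuousAt.comp (g := fun g : K => AdE E g Y) ?_
      (continuous_const_mul k⁻¹).continuousAt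
    rwa [inv_mul_cancel]
  refine h2.congr (Eventually.of_forall fun g => ?_)
  have h3 := Ad_mul k (k⁻¹ * g) Y
  rw [mul_inv_cancel_left] at h3
  exact h3.symm

end Adjoint

/-! ### Existence of one-parameter subgroups -/

section OneParam
open Filter Topology

/-- Solutions of a smooth autonomous differential equation are smooth. -/
lemma contDiffAt_of_hasDerivAt {E : Type*} [NormedAddCommGroup E] [NormedSpace ℝ E] {x : ℝ → E}
    {F : E → E} (hF : ContDiffAt ℝ ∞ F (x 0)) (hx : ∀ᶠ s in 𝓝 0, HasDerivAt x (F (x s)) s) :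
    ContDiffAt ℝ ∞ x 0 := by
  rw [contDiffAt_infty]
  intro n
  induction n with
  | zero =>
    obtain ⟨u, hu, h⟩ := hx.exists_mem
    exact contDiffAt_zero.2 ⟨u, hu, fun s hs => (h s hs).continuousAt.continuousWithinAt⟩
  | succ n ih =>
    obtain ⟨u, hu, h⟩ := hx.exists_mem
    refine contDiffAt_succ_iff_hasFDerivAt.2
      ⟨fun s => ContinuousLinearMap.toSpanSingleton ℝ (F (x s)),
        ⟨u, hu, fun s hs => (h s hs).hasFDerivAt⟩, ?_⟩
    exact (ContinuousLinearMap.toSpanSingletonCLE (𝕜 := ℝ) (E := E)).contDiff.contDiffAt.comp 0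
      ((hF.of_le (WithTop.coe_le_coe.2 le_top)).comp 0 ih)

variable {E : Type*} [NormedAddCommGroup E] [NormedSpace ℝ E]
  {K : Type*} [TopologicalSpace K] [ChartedSpace E K] [Group K] [LieGroup 𝓘(ℝ, E) ∞ K]

lemma mfderiv_mul_left_mulInvariantVectorField (X : GroupLieAlgebra 𝓘(ℝ, E) K) (k g : K) :
    (mfderiv 𝓘(ℝ, E) 𝓘(ℝ, E) (fun g : K => k * g) g : E →L[ℝ] E) (mulInvariantVectorField X g) =
      mulInvariantVectorField X (k * g) := by
  have h := mfderiv_comp_model_apply (E := E) (E' := E) (E'' := E) (x := (1 : K)) (y := g)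
    (g := fun h : K => k * h) (f := fun h : K => g * h) (mul_one g)
    (mdifferentiableAt_mul_left k g) (mdifferentiableAt_mul_left g 1) X
  have h2 : (fun x : K => k * (g * x)) = fun x => k * g * x := by
    ext x; rw [mul_assoc]
  rw [h2] at h
  exact h.symm

/-- Left translates of integral curves of left-invariant vector fields are integral curves. -/
lemma isMIntegralCurveOn_mul_left {X : GroupLieAlgebra 𝓘(ℝ, E) K} {γ : ℝ → K} {s : Set ℝ}
    (h : IsMIntegralCurveOn (I := 𝓘(ℝ, E)) γ (mulInvariantVectorField X) s) (k : K) :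
    IsMIntegralCurveOn (I := 𝓘(ℝ, E)) (fun t => k * γ t) (mulInvariantVectorField X) s := by
  intro t ht
  have h1 := (mdifferentiableAt_mul_left (E := E) k (γ t)).hasMFDerivAt.comp_hasMFDerivWithinAt t
    (h t ht)
  refine h1.congr_mfderiv ?_
  refine ContinuousLinearMap.ext fun (r : ℝ) => ?_
  have h2 := mfderiv_mul_left_mulInvariantVectorField X k (γ t)
  refine (ContinuousLinearMap.map_smul
    (mfderiv 𝓘(ℝ, E) 𝓘(ℝ, E) (fun g : K => k * g) (γ t) : E →L[ℝ] E) r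
      (mulInvariantVectorField X (γ t) : E)).trans ?_
  exact congrArg (fun v : E => r • v) h2

lemma isMIntegralCurve_mul_left {X : GroupLieAlgebra 𝓘(ℝ, E) K} {γ : ℝ → K}
    (h : IsMIntegralCurve (I := 𝓘(ℝ, E)) γ (mulInvariantVectorField X)) (k : K) :
    IsMIntegralCurve (I := 𝓘(ℝ, E)) (fun t => k * γ t) (mulInvariantVectorField X) := by
  rw [isMIntegralCurve_iff_isMIntegralCurveOn] at h ⊢
  exact isMIntegralCurveOn_mul_left h k

lemma contMDiff_one_mulInvariantVectorField (X : GroupLieAlgebra 𝓘(ℝ, E) K) :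
    ContMDiff 𝓘(ℝ, E) 𝓘(ℝ, E).tangent 1
      (fun g : K => (⟨g, mulInvariantVectorField X g⟩ : TangentBundle 𝓘(ℝ, E) K)) := by
  refine (contMDiff_mulInvariantVectorField X).of_le ?_
  rw [minSmoothness_of_isRCLikeNormedField]
  norm_num

variable [T2Space K] [CompleteSpace E]

/-- Left-invariant vector fields are complete: by left translation, integral curves through all
points exist for the same time. -/
lemma exists_isMIntegralCurve (X : GroupLieAlgebra 𝓘(ℝ, E) K) :
    ∃ γ : ℝ → K, γ 0 = 1 ∧ IsMIntegralCurve (I := 𝓘(ℝ, E)) γ (mulInvariantVectorField X) := by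
  have hv := contMDiff_one_mulInvariantVectorField X
  obtain ⟨γ, h0, hγ⟩ := exists_isMIntegralCurveAt_of_contMDiffAt_boundaryless 0
    (hv.contMDiffAt (x := 1))
  obtain ⟨ε, hε, h⟩ := isMIntegralCurveAt_iff'.1 hγ
  refine exists_isMIntegralCurve_of_isMIntegralCurveOn hv hε (fun x => ?_) 1
  refine ⟨fun t => x * γ t, by simp only [h0, mul_one], ?_⟩
  rw [Real.ball_eq_Ioo, zero_sub, zero_add] at h
  exact isMIntegralCurveOn_mul_left h x

/-- Every element of the Lie algebra is the velocity of a smooth one-parameter subgroup. -/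
theorem exists_isOneParam (X : GroupLieAlgebra 𝓘(ℝ, E) K) : ∃ γ : ℝ → K, IsOneParam γ X := by
  obtain ⟨γ, h0, hγ⟩ := exists_isMIntegralCurve X
  have hadd : ∀ a b, γ (a + b) = γ a * γ b := by
    intro a b
    have h1 := isMIntegralCurve_Ioo_eq_of_contMDiff_boundaryless (t₀ := 0)
      (contMDiff_one_mulInvariantVectorField X) (hγ.comp_add a) (isMIntegralCurve_mul_left hγ (γ a))
      (by simp [h0])
    have h2 := congrFun h1 b
    simpa [add_comm] using h2
  have hder : (mfderiv 𝓘(ℝ, ℝ) 𝓘(ℝ, E) γ 0 (1 : ℝ) : E) = X := by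
    have h1 : (mfderiv 𝓘(ℝ, ℝ) 𝓘(ℝ, E) γ 0 : ℝ →L[ℝ] E) =
        ContinuousLinearMap.toSpanSingleton ℝ (mulInvariantVectorField X (γ 0) : E) :=
      (hγ 0).mfderiv
    have h2 := congrArg (fun T : ℝ →L[ℝ] E => T 1) h1
    refine h2.trans ?_
    have h3 : ∀ g : K, g = 1 → (mulInvariantVectorField X g : E) = X := by
      rintro _ rfl
      have h4 : (fun g : K => 1 * g) = id := by ext; simp
      have h5 : (mulInvariantVectorField X 1 : E) =
        (mfderiv 𝓘(ℝ, E) 𝓘(ℝ, E) (fun g : K => 1 * g) 1 : E →L[ℝ] E) X := rfl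
      rw [h4] at h5
      exact h5.trans
        (congrArg (fun T : E →L[ℝ] E => T X) (mfderiv_id (I := 𝓘(ℝ, E)) (x := (1 : K))))
    refine Eq.trans ?_ (h3 _ h0)
    exact one_smul ℝ (mulInvariantVectorField X (γ 0) : E)
  refine ⟨γ, ?_, hadd, hder⟩
  -- smoothness at `0` follows from the equation in the chart, smoothness at `s` by translation
  set e := unitChart E K (1 : K) with he
  have hsrc : ∀ᶠ s in 𝓝 (0 : ℝ), γ s ∈ (unitChart E K).source := by
    refine hγ.continuous.continuousAt.eventually ?_
    rw [h0]
    exact extChartAt_source_mem_nhds (1 : K)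
  have hcx : Tendsto (fun s => unitChart E K (γ s)) (𝓝 0) (𝓝 e) := by
    have h1 : ContinuousAt (unitChart E K) (γ 0) := by
      rw [h0]; exact continuousAt_extChartAt (1 : K)
    have h2 : ContinuousAt (fun s => unitChart E K (γ s)) 0 :=
      ContinuousAt.comp (f := γ) h1 hγ.continuous.continuousAt
    have h3 := h2.tendsto
    rwa [h0] at h3
  -- the equation satisfied by the curve in the chart
  have hode : ∀ᶠ s in 𝓝 (0 : ℝ), HasDerivAt (fun s => unitChart E K (γ s))
      (fderiv ℝ (localMul E K) (unitChart E K (γ s), e) ((0, X) : E × E)) s := by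
    filter_upwards [hsrc, hcx.eventually (mfderiv_unitChart_mulInvariantVectorField X)]
      with s hs hX
    rw [(unitChart E K).left_inv hs] at hX
    have hφ : MDifferentiableAt 𝓘(ℝ, E) 𝓘(ℝ, E) (unitChart E K) (γ s) :=
      mdifferentiableAt_extChartAt (by rwa [extChartAt_source] at hs)
    have hd : MDifferentiableAt 𝓘(ℝ, ℝ) 𝓘(ℝ, E) (fun s => unitChart E K (γ s)) s :=
      hφ.comp s (hγ s).mdifferentiableAt
    have h2 := mfderiv_comp_model_apply (E := ℝ) (E' := E) (E'' := E) rfl hφ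
      (hγ s).mdifferentiableAt 1
    have h1 : (mfderiv 𝓘(ℝ, ℝ) 𝓘(ℝ, E) γ s : ℝ →L[ℝ] E) =
        ContinuousLinearMap.toSpanSingleton ℝ (mulInvariantVectorField X (γ s) : E) :=
      (hγ s).mfderiv
    have h3 : (mfderiv 𝓘(ℝ, ℝ) 𝓘(ℝ, E) γ s : ℝ →L[ℝ] E) 1 =
        (mulInvariantVectorField X (γ s) : E) := by
      rw [h1]; exact one_smul ℝ (mulInvariantVectorField X (γ s) : E)
    have h5 := h2.trans ((congrArg (mfderiv 𝓘(ℝ, E) 𝓘(ℝ, E) (unitChart E K) (γ s) : E →L[ℝ] E)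
      h3).trans hX)
    have h4 := (mdifferentiableAt_iff_differentiableAt.1 hd).hasDerivAt
    rw [← fderiv_apply_one_eq_deriv, ← mfderiv_eq_fderiv] at h4
    exact h5 ▸ h4
  have hsm : ContDiffAt ℝ ∞ (fun s => unitChart E K (γ s)) 0 := by
    refine contDiffAt_of_hasDerivAt
      (F := fun x => fderiv ℝ (localMul E K) (x, e) ((0, X) : E × E)) ?_ hode
    rw [h0]
    have h1 : ContDiffAt ℝ ∞ (fderiv ℝ (localMul E K)) (e, e) :=
      contDiffAt_localMul.fderiv_right (by simp)
    have h2 : ContDiffAt ℝ ∞ (fun x : E => fderiv ℝ (localMul E K) (x, e)) e :=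
      ContDiffAt.comp e (f := fun x : E => (x, e)) h1 (contDiffAt_id.prodMk contDiffAt_const)
    exact h2.clm_apply contDiffAt_const
  have hsm0 : ContMDiffAt 𝓘(ℝ, ℝ) 𝓘(ℝ, E) ∞ γ 0 := by
    have h1 : ContMDiffAt 𝓘(ℝ, ℝ) 𝓘(ℝ, E) ∞
        (fun s => (unitChart E K).symm (unitChart E K (γ s))) 0 := by
      refine ContMDiffAt.comp (0 : ℝ) (g := (unitChart E K).symm) ?_ hsm.contMDiffAt
      rw [h0]
      exact contMDiffAt_unitChart_symm
    refine h1.congr_of_eventuallyEq ?_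
    filter_upwards [hsrc] with s hs
    rw [(unitChart E K).left_inv hs]
  intro s
  have h1 : γ = fun u => γ s * γ (u - s) := by
    ext u
    rw [← hadd]
    congr 1
    ring
  rw [h1]
  refine ContMDiffAt.mul contMDiffAt_const ?_
  refine ContMDiffAt.comp s (g := γ) (by rwa [sub_self]) ?_
  exact (contDiff_id.sub contDiff_const).contMDiff.contMDiffAt

/-- Proved by differentiating `Ad (k γ(s) k⁻¹) (Ad k Y) = Ad k (Ad (γ(s)) Y)`, for the one-parameter
subgroup `γ` of velocity `X`. -/
lemma Ad_lie (k : K) (X Y : GroupLieAlgebra 𝓘(ℝ, E) K) :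
    Ad k ⁅X, Y⁆ = ⁅Ad k X, Ad k Y⁆ := by
  obtain ⟨γ, hγ⟩ := exists_isOneParam X
  have h1 := (hγ.conj k).hasDerivAt_Ad (Ad k Y) 0
  have h2 : HasDerivAt (fun s => AdE E k (AdE E (γ s) Y))
      (AdE E k (AdE E (γ 0) (⁅X, Y⁆ : GroupLieAlgebra 𝓘(ℝ, E) K))) 0 :=
    (AdE E k).hasFDerivAt.comp_hasDerivAt 0 (hγ.hasDerivAt_Ad Y 0)
  have h3 : (fun s => AdE E (k * γ s * k⁻¹) (Ad k Y)) = fun s => AdE E k (AdE E (γ s) Y) := by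
    ext s
    change Ad (k * γ s * k⁻¹) (Ad k Y) = Ad k (Ad (γ s) Y)
    rw [Ad_mul, Ad_inv_apply, Ad_mul]
  rw [h3] at h1
  have h4 := h2.unique h1
  change Ad k (Ad (γ 0) ⁅X, Y⁆) = Ad (k * γ 0 * k⁻¹) ⁅Ad k X, Ad k Y⁆ at h4
  rwa [hγ.zero, mul_one, mul_inv_cancel, Ad_one, Ad_one] at h4

/-- `Ad k` as an automorphism of the Lie algebra. -/
def AdEquiv (k : K) : GroupLieAlgebra 𝓘(ℝ, E) K ≃ₗ⁅ℝ⁆ GroupLieAlgebra 𝓘(ℝ, E) K where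
  toLinearMap := Ad k
  map_lie' := Ad_lie k _ _
  invFun := Ad k⁻¹
  left_inv := Ad_inv_apply k
  right_inv := Ad_apply_inv k

end OneParam

/-! ### Averaged invariant forms -/

section InvariantForm
open Filter Topology MeasureTheory

variable {E : Type*} [NormedAddCommGroup E] [NormedSpace ℝ E] [FiniteDimensional ℝ E]
  {K : Type*} [TopologicalSpace K] [ChartedSpace E K] [Group K] [LieGroup 𝓘(ℝ, E) ∞ K]

/-- A positive definite invariant form on the Lie algebra of a compact group, by averaging. -/
lemma exists_invariant_form [CompactSpace K] :
    ∃ B : GroupLieAlgebra 𝓘(ℝ, E) K →ₗ[ℝ] GroupLieAlgebra 𝓘(ℝ, E) K →ₗ[ℝ] ℝ,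
      (∀ X, X ≠ 0 → 0 < B X X) ∧ ∀ k X Y, B (Ad k X) (Ad k Y) = B X Y := by
  have : IsTopologicalGroup K := topologicalGroup_of_lieGroup 𝓘(ℝ, E) ∞
  have : CompleteSpace E := FiniteDimensional.complete ℝ E
  let _ : MeasurableSpace K := borel K
  have : BorelSpace K := ⟨rfl⟩
  let μ : Measure K := Measure.haar
  let q : K → E → E → ℝ := fun k X Y =>
    inner ℝ (toEuclidean (AdE E k⁻¹ X)) (toEuclidean (AdE E k⁻¹ Y))
  have hcont : ∀ X Y, Continuous fun k => q k X Y := fun X Y =>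
    (toEuclidean.continuous.comp ((continuous_Ad (K := K) X).comp continuous_inv)).inner
      (toEuclidean.continuous.comp ((continuous_Ad (K := K) Y).comp continuous_inv))
  have hint : ∀ X Y, Integrable (fun k => q k X Y) μ := fun X Y =>
    (hcont X Y).integrable_of_hasCompactSupport (HasCompactSupport.of_compactSpace _)
  let B : E →ₗ[ℝ] E →ₗ[ℝ] ℝ := LinearMap.mk₂ ℝ (fun X Y => ∫ k, q k X Y ∂μ)
    (fun X X' Y => by
      rw [← integral_add (hint _ _) (hint _ _)]
      simp only [q, map_add, inner_add_left])
    (fun c X Y => by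
      rw [smul_eq_mul, ← integral_const_mul]
      simp only [q, map_smul, real_inner_smul_left])
    (fun X Y Y' => by
      rw [← integral_add (hint _ _) (hint _ _)]
      simp only [q, map_add, inner_add_right])
    (fun c X Y => by
      rw [smul_eq_mul, ← integral_const_mul]
      simp only [q, map_smul, real_inner_smul_right])
  refine ⟨B, fun X hX => ?_, fun k X Y => ?_⟩
  · refine (hcont X X).integral_pos_of_hasCompactSupport_nonneg_nonzero (x := 1)
      (HasCompactSupport.of_compactSpace _) (fun k => real_inner_self_nonneg) ?_
    have h1 : AdE E (1 : K)⁻¹ X = X := by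
      rw [inv_one]; exact Ad_one (K := K) X
    simp only [q, h1]
    rw [inner_self_ne_zero]
    exact (map_ne_zero_iff _ toEuclidean.injective).2 hX
  · have h1 : ∀ (g : K) (X Y : E), q g (AdE E k X) (AdE E k Y) = q (k⁻¹ * g) X Y := fun g X Y => by
      have h2 : ∀ Z : E, AdE E g⁻¹ (AdE E k Z) = AdE E (k⁻¹ * g)⁻¹ Z := fun Z => by
        rw [mul_inv_rev, inv_inv]
        exact (Ad_mul g⁻¹ k Z).symm
      simp only [q, h2]
    exact (integral_congr_ae (Eventually.of_forall fun g => h1 g X Y)).trans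
      (integral_mul_left_eq_self (μ := μ) (fun g => q g X Y) k⁻¹)

lemma IsOneParam.hasDerivAt_functional {γ : ℝ → K} {U : GroupLieAlgebra 𝓘(ℝ, E) K}
    (h : IsOneParam γ U) (ℓ : Module.Dual ℝ (GroupLieAlgebra 𝓘(ℝ, E) K))
    (Y : GroupLieAlgebra 𝓘(ℝ, E) K) (s : ℝ) :
    HasDerivAt (fun s => ℓ (Ad (γ s) Y)) (ℓ (Ad (γ s) ⁅U, Y⁆)) s := by
  have : CompleteSpace E := FiniteDimensional.complete ℝ E
  let T : E →L[ℝ] ℝ := LinearMap.toContinuousLinearMap (E := E) ℓ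
  exact T.hasFDerivAt.comp_hasDerivAt s (h.hasDerivAt_Ad Y s)

/-- Invariance under the group implies invariance under the Lie algebra. -/
lemma form_lie [T2Space K] {B : GroupLieAlgebra 𝓘(ℝ, E) K →ₗ[ℝ] GroupLieAlgebra 𝓘(ℝ, E) K →ₗ[ℝ] ℝ}
    (hB : ∀ k X Y, B (Ad k X) (Ad k Y) = B X Y) (U X Y : GroupLieAlgebra 𝓘(ℝ, E) K) :
    B ⁅U, X⁆ Y = -B X ⁅U, Y⁆ := by
  have : CompleteSpace E := FiniteDimensional.complete ℝ E
  obtain ⟨γ, hγ⟩ := exists_isOneParam U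
  have h1 := hγ.hasDerivAt_functional (B.flip Y) X 0
  have h2 := hγ.hasDerivAt_functional (B X) Y (-0)
  have h3 := HasDerivAt.scomp (0 : ℝ) h2 (hasDerivAt_neg 0)
  have h4 : (fun s => B.flip Y (Ad (γ s) X)) = (fun s => B X (Ad (γ s) Y)) ∘ Neg.neg := by
    ext s
    have h5 : γ s * γ (-s) = 1 := by rw [← hγ.add, add_neg_cancel, hγ.zero]
    have h6 : Ad (γ s) (Ad (γ (-s)) Y) = Y := by rw [← Ad_mul, h5, Ad_one]
    have h7 := hB (γ s) X (Ad (γ (-s)) Y)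
    rw [h6] at h7
    exact h7
  rw [h4] at h1
  have h8 := h1.unique h3
  simpa [hγ.zero, Ad_one] using h8

end InvariantForm

/-- The first and second derivative tests at a minimum. -/
lemma deriv_conditions_of_min {g g₁ : ℝ → ℝ} {c : ℝ} (h : ∀ s, HasDerivAt g (g₁ s) s)
    (h₁ : HasDerivAt g₁ c 0) (hmin : ∀ s, g 0 ≤ g s) : g₁ 0 = 0 ∧ 0 ≤ c := by
  have hd : deriv g = g₁ := funext fun s => (h s).deriv
  have hloc : IsLocalMin g 0 := Filter.Eventually.of_forall hmin
  have h0 : g₁ 0 = 0 := by rw [← hd]; exact hloc.deriv_eq_zero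
  refine ⟨h0, not_lt.1 fun hc => ?_⟩
  have hmax : IsLocalMax g 0 := by
    refine isLocalMax_of_deriv_deriv_neg ?_ (by rw [hd, h0]) (h 0).continuousAt
    rw [hd, h₁.deriv]; exact hc
  have hconst : g =ᶠ[nhds 0] fun _ => g 0 := hmax.mono fun s hs => le_antisymm hs (hmin s)
  have h2 : deriv (deriv g) 0 = 0 := by
    have h3 := hconst.deriv.deriv_eq
    simpa using h3
  rw [hd, h₁.deriv] at h2
  exact hc.ne h2

/-! ### The longest element of the Weyl group -/

section Weyl
open Filter Topology

variable {E : Type*} [NormedAddCommGroup E] [NormedSpace ℝ E] [FiniteDimensional ℝ E]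
  {K : Type*} [TopologicalSpace K] [ChartedSpace E K] [Group K] [LieGroup 𝓘(ℝ, E) ∞ K]
  (D : TriangularDecomposition (GroupLieAlgebra 𝓘(ℝ, E) K))

omit [FiniteDimensional ℝ E] [LieGroup 𝓘(ℝ, E) ∞ K] in
lemma IsOneParam.comp_mul {γ : ℝ → K} {X : GroupLieAlgebra 𝓘(ℝ, E) K} (h : IsOneParam γ X)
    (r : ℝ) : IsOneParam (fun s => γ (r * s)) (r • X) where
  smooth := h.smooth.comp (contDiff_const.mul contDiff_id).contMDiff
  add a b := by rw [mul_add, h.add]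
  deriv := by
    have hd : HasDerivAt (fun s : ℝ => r * s) r 0 := by
      simpa using (hasDerivAt_id (0 : ℝ)).const_mul r
    have h1 := mfderiv_comp_model_apply (E := ℝ) (E' := ℝ) (E'' := E) (x := (0 : ℝ)) (y := (0 : ℝ))
      (g := γ) (f := fun s : ℝ => r * s) (mul_zero r) (h.mdifferentiableAt 0)
      hd.differentiableAt.mdifferentiableAt 1
    have h2 : (mfderiv 𝓘(ℝ, ℝ) 𝓘(ℝ, ℝ) (fun s : ℝ => r * s) 0 : ℝ →L[ℝ] ℝ) 1 = r • (1 : ℝ) := by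
      have h3 : (mfderiv 𝓘(ℝ, ℝ) 𝓘(ℝ, ℝ) (fun s : ℝ => r * s) 0 : ℝ →L[ℝ] ℝ) =
        fderiv ℝ (fun s : ℝ => r * s) 0 := mfderiv_eq_fderiv
      have h4 : fderiv ℝ (fun s : ℝ => r * s) 0 1 = r • (1 : ℝ) := by
        rw [fderiv_apply_one_eq_deriv, hd.deriv, smul_eq_mul, mul_one]
      exact (congrArg (fun T : ℝ →L[ℝ] ℝ => T 1) h3).trans h4
    refine h1.trans ((congrArg (mfderiv 𝓘(ℝ, ℝ) 𝓘(ℝ, E) γ 0 : ℝ →L[ℝ] E) h2).trans ?_)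
    refine (ContinuousLinearMap.map_smul (mfderiv 𝓘(ℝ, ℝ) 𝓘(ℝ, E) γ 0 : ℝ →L[ℝ] E) r 1).trans ?_
    exact congrArg (fun v : E => r • v) h.deriv

lemma IsOneParam.mem_torus {γ : ℝ → K} {X : GroupLieAlgebra 𝓘(ℝ, E) K} (h : IsOneParam γ X)
    (hX : X ∈ D.t) (s : ℝ) : γ s ∈ torus D :=
  mem_expSet.2 ⟨_, _, D.t.smul_mem s hX, h.comp_mul s, by rw [mul_one]⟩

/-- The torus centralizes its Lie algebra. -/
lemma Ad_of_mem_torus {τ : K} (hτ : τ ∈ torus D) {Y : GroupLieAlgebra 𝓘(ℝ, E) K} (hY : Y ∈ D.t) :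
    Ad τ Y = Y := by
  have : CompleteSpace E := FiniteDimensional.complete ℝ E
  obtain ⟨η, X, hX, hη, rfl⟩ := mem_expSet.1 hτ
  have h1 : ∀ s, HasDerivAt (fun s => AdE E (η s) Y) 0 s := fun s => by
    have h2 := hη.hasDerivAt_Ad Y s
    rw [D.abelian X hX Y hY] at h2
    have h3 : AdE E (η s) (0 : E) = 0 := map_zero _
    exact h3 ▸ h2
  have h4 := is_const_of_deriv_eq_zero (fun s => (h1 s).differentiableAt)
    (fun s => (h1 s).deriv) 1 0
  refine h4.trans ?_
  rw [hη.zero]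
  exact Ad_one Y

/-- The normalizer of the torus preserves the maximal abelian subalgebra. -/
lemma Ad_mem_of_mem_torusNormalizer [T2Space K] {w : K} (hw : w ∈ torusNormalizer D)
    {X : GroupLieAlgebra 𝓘(ℝ, E) K} (hX : X ∈ D.t) : Ad w X ∈ D.t := by
  have : CompleteSpace E := FiniteDimensional.complete ℝ E
  obtain ⟨γ, hγ⟩ := exists_isOneParam X
  refine D.maximal _ fun Y hY => ?_
  -- the conjugate one-parameter subgroup stays in the torus, hence fixes `Y`
  have h1 : ∀ s, AdE E (w * γ s * w⁻¹) Y = Y := fun s =>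
    Ad_of_mem_torus D ((hw _).1 (hγ.mem_torus D hX s)) hY
  have h2 := (hγ.conj w).hasDerivAt_Ad Y 0
  have h3 : HasDerivAt (fun s : ℝ => AdE E (w * γ s * w⁻¹) Y) 0 0 :=
    (hasDerivAt_const (F := E) (0 : ℝ) Y).congr_of_eventuallyEq (Eventually.of_forall h1)
  have h4 := h2.unique h3
  change Ad (w * γ 0 * w⁻¹) ⁅Ad w X, Y⁆ = 0 at h4
  rwa [hγ.zero, mul_one, mul_inv_cancel, Ad_one] at h4

lemma mem_torusNormalizer_of_Ad {k : K} (h : ∀ X ∈ D.t, Ad k X ∈ D.t)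
    (h' : ∀ X ∈ D.t, Ad k⁻¹ X ∈ D.t) : k ∈ torusNormalizer D := by
  have key : ∀ g : K, (∀ X ∈ D.t, Ad g X ∈ D.t) → ∀ n ∈ torus D, g * n * g⁻¹ ∈ torus D := by
    intro g hg n hn
    obtain ⟨γ, X, hX, hγ, rfl⟩ := mem_expSet.1 hn
    exact mem_expSet.2 ⟨_, _, hg X hX, hγ.conj g, rfl⟩
  intro n
  refine ⟨key k h n, fun hn => ?_⟩
  have h1 := key k⁻¹ h' _ hn
  have h2 : k⁻¹ * (k * n * k⁻¹) * k⁻¹⁻¹ = n := by group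
  rwa [h2] at h1

/-- The functional `lam ∘ Ad(k)⁻¹` on `t`, for `k` preserving `t`. -/
def translateDual {k : K} (h' : ∀ X ∈ D.t, Ad k⁻¹ X ∈ D.t) (lam : Module.Dual ℝ D.t) :
    Module.Dual ℝ D.t :=
  lam ∘ₗ (Ad k⁻¹ : GroupLieAlgebra 𝓘(ℝ, E) K →ₗ[ℝ] GroupLieAlgebra 𝓘(ℝ, E) K).restrict h'

lemma translateDual_apply {k : K} (h' : ∀ X ∈ D.t, Ad k⁻¹ X ∈ D.t) (lam : Module.Dual ℝ D.t)
    {X Y : D.t} (hXY : (Y : GroupLieAlgebra 𝓘(ℝ, E) K) = Ad k (X : GroupLieAlgebra 𝓘(ℝ, E) K)) :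
    translateDual D h' lam Y = lam X := by
  simp only [translateDual, LinearMap.comp_apply]
  congr 1
  ext
  rw [LinearMap.coe_restrict_apply, hXY, Ad_inv_apply]

/-- Some element of the normalizer of the torus carries all the positive roots to negative ones:
it minimizes `k ↦ ⟨Ad(k) X₀, X₀⟩`, for `X₀` in the Weyl chamber. At a critical point, `Ad(k) X₀`
commutes with `X₀`, so that `Ad(k)` preserves `t`; and the second derivative in the direction of the
real part of a root vector has the sign of `-α(X₀) α(Ad(k) X₀)`. -/
theorem exists_pos_subset_inversions [T2Space K] [CompactSpace K] :
    ∃ k ∈ torusNormalizer D, D.pos ⊆ inversions D k := by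
  have : CompleteSpace E := FiniteDimensional.complete ℝ E
  obtain ⟨X₀, hreg, hpos⟩ := D.exists_chamber
  obtain ⟨B, hBpos, hBinv⟩ := exists_invariant_form (E := E) (K := K)
  let f : K → ℝ := fun k => B.flip X₀ (Ad k X₀)
  have hf : Continuous f := by
    let T : E →L[ℝ] ℝ := LinearMap.toContinuousLinearMap (E := E) (B.flip X₀)
    exact T.continuous.comp (continuous_Ad (K := K) (X₀ : GroupLieAlgebra 𝓘(ℝ, E) K))
  obtain ⟨k, -, hk⟩ := isCompact_univ.exists_isMinOn (Set.univ_nonempty (α := K)) hf.continuousOn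
  have hmin : ∀ g, f k ≤ f g := fun g => hk (Set.mem_univ g)
  set Y : GroupLieAlgebra 𝓘(ℝ, E) K := Ad k X₀ with hY
  have hcrit : ∀ U : GroupLieAlgebra 𝓘(ℝ, E) K, B ⁅U, Y⁆ X₀ = 0 ∧ 0 ≤ B ⁅U, ⁅U, Y⁆⁆ X₀ := by
    intro U
    obtain ⟨γ, hγ⟩ := exists_isOneParam U
    have h1 := hγ.hasDerivAt_functional (B.flip X₀) Y
    have h2 := hγ.hasDerivAt_functional (B.flip X₀) ⁅U, Y⁆ 0
    have h3 := deriv_conditions_of_min h1 h2 fun s => by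
      rw [hγ.zero, Ad_one, hY, ← Ad_mul]
      exact hmin (γ s * k)
    simpa [hγ.zero, Ad_one] using h3
  -- the first-order condition
  have hcomm : ⁅Y, (X₀ : GroupLieAlgebra 𝓘(ℝ, E) K)⁆ = 0 := by
    by_contra hne
    have h1 := (hcrit ⁅Y, (X₀ : GroupLieAlgebra 𝓘(ℝ, E) K)⁆).1
    rw [← lie_skew, map_neg, LinearMap.neg_apply, form_lie hBinv, neg_neg] at h1
    exact (hBpos _ hne).ne' h1
  have hYt : Y ∈ D.t := D.mem_t_of_lie_eq_zero hreg (by rw [← lie_skew, hcomm, neg_zero])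
  have h' : ∀ X ∈ D.t, Ad k⁻¹ X ∈ D.t := fun X hX => by
    refine D.mem_t_of_lie_eq_zero hreg ?_
    have h1 : (X₀ : GroupLieAlgebra 𝓘(ℝ, E) K) = Ad k⁻¹ Y := by rw [hY, Ad_inv_apply]
    rw [h1, ← Ad_lie, D.abelian Y hYt X hX, map_zero]
  have h : ∀ X ∈ D.t, Ad k X ∈ D.t := fun X hX => by
    have h1 : Function.Injective
        ((Ad k⁻¹ : GroupLieAlgebra 𝓘(ℝ, E) K →ₗ[ℝ] GroupLieAlgebra 𝓘(ℝ, E) K).restrict h') := by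
      intro Z Z' hZ
      have h2 := congrArg (fun V : D.t => Ad k (V : GroupLieAlgebra 𝓘(ℝ, E) K)) hZ
      simp only [LinearMap.coe_restrict_apply, Ad_apply_inv] at h2
      exact Subtype.ext h2
    obtain ⟨Z, hZ⟩ := LinearMap.injective_iff_surjective.1 h1 ⟨X, hX⟩
    have h3 := congrArg (fun V : D.t => Ad k (V : GroupLieAlgebra 𝓘(ℝ, E) K)) hZ
    simp only [LinearMap.coe_restrict_apply, Ad_apply_inv] at h3
    rw [← h3]
    exact Z.2
  refine ⟨k, mem_torusNormalizer_of_Ad D h h', fun lam hlam => ?_⟩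
  have hlam' := hlam
  rw [hpos] at hlam'
  obtain ⟨⟨hlam0, hne⟩, hlampos⟩ := hlam'
  -- the translate of `lam`, a root
  set α := translateDual D h' lam with hα
  have hαapp : ∀ X Y : D.t,
      (Y : GroupLieAlgebra 𝓘(ℝ, E) K) = Ad k (X : GroupLieAlgebra 𝓘(ℝ, E) K) → α Y = lam X :=
    fun X Y hXY => translateDual_apply D h' lam hXY
  have hαY : α ⟨Y, hYt⟩ = lam X₀ := hαapp X₀ ⟨Y, hYt⟩ rfl
  have hαne : rootSpace D.t α ≠ ⊥ := by
    obtain ⟨Z, hZ, hZ0⟩ := Submodule.exists_mem_ne_zero_of_ne_bot hne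
    have h1 := baseChange_mem_rootSpace (AdEquiv k) h' hαapp hZ
    refine fun hbot => hZ0 ?_
    rw [hbot, Submodule.mem_bot] at h1
    rw [← baseChange_apply_symm (AdEquiv k).symm Z]
    exact (congrArg _ h1).trans (map_zero _)
  have hα0 : α ≠ 0 := fun h0 => by
    rw [h0, LinearMap.zero_apply] at hαY
    exact hlampos.ne hαY
  have hαX₀ : α X₀ ≠ 0 := hreg α ⟨hα0, hαne⟩
  -- the second-order condition
  have hαneg : α X₀ < 0 := by
    obtain ⟨U, V, hV, hU1, hV1⟩ := exists_root_plane hαne hαX₀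
    have h1 := (hcrit U).2
    have h2 : ⁅U, Y⁆ = -(lam X₀ • V) := by
      rw [← lie_skew, ← hαY]
      exact congrArg Neg.neg (hU1 ⟨Y, hYt⟩)
    have h3 : B ⁅U, V⁆ X₀ = α X₀ * B V V := by
      rw [form_lie hBinv, ← lie_skew, hU1 X₀, map_neg, map_smul, neg_neg, smul_eq_mul]
    rw [h2, lie_neg, lie_smul, map_neg, map_smul, LinearMap.neg_apply, LinearMap.smul_apply, h3,
      smul_eq_mul] at h1
    by_contra hge
    have h4 : 0 < α X₀ := lt_of_le_of_ne (not_lt.1 hge) hαX₀.symm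
    have h5 : 0 < lam X₀ * (α X₀ * B V V) := mul_pos hlampos (mul_pos h4 (hBpos V hV))
    linarith
  refine ⟨hlam, -α, ?_, fun X Y' hXY => by rw [LinearMap.neg_apply, hαapp X Y' hXY]⟩
  rw [hpos]
  refine ⟨⟨neg_ne_zero.2 hα0, fun hbot => ?_⟩, by rw [LinearMap.neg_apply]; linarith⟩
  obtain ⟨Z, hZ, hZ0⟩ := Submodule.exists_mem_ne_zero_of_ne_bot hαne
  have h1 := conj_mem_rootSpace hZ
  rw [hbot, Submodule.mem_bot] at h1
  have h2 : ∀ Z : ℂ ⊗[ℝ] GroupLieAlgebra 𝓘(ℝ, E) K, conj _ (conj _ Z) = Z := fun Z => by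
    induction Z with
    | zero => simp
    | tmul z Y => simp [conj]
    | add a b ha hb => simp only [map_add, ha, hb]
  rw [← h2 Z, h1, map_zero] at hZ0
  exact hZ0 rfl

/-- A representative of the longest element of the Weyl group reverses the triangular
decomposition. -/
theorem IsLongestRep.reverses [T2Space K] [CompactSpace K] [CompleteSpace E] {w₀ : K}
    (hw₀ : IsLongestRep D w₀) : D.Reverses (AdEquiv w₀) := by
  obtain ⟨k, hk, hkpos⟩ := exists_pos_subset_inversions D
  have hsub : ∀ w : K, inversions D w ⊆ D.pos := fun w lam hl => hl.1
  have hk' : inversions D k = D.pos := Set.Subset.antisymm (hsub k) hkpos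
  have hle : D.pos.ncard ≤ (inversions D w₀).ncard := by
    rw [← hk']
    exact hw₀.2 k hk
  have heq := Set.eq_of_subset_of_ncard_le (hsub w₀) hle D.finite_pos
  refine ⟨fun X hX => Ad_mem_of_mem_torusNormalizer D hw₀.1 hX,
    fun X hX => Ad_mem_of_mem_torusNormalizer D (inv_mem hw₀.1) hX, fun lam hl => ?_⟩
  rw [← heq] at hl
  exact hl.2

end Weyl

/-! ### Left translation of invariant bivector fields -/

section Bivectors

lemma Bivector.push_sub {V V' : Type*} [AddCommGroup V] [Module ℝ V] [AddCommGroup V']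
    [Module ℝ V'] (A : V →ₗ[ℝ] V') (B B' : Bivector V) :
    Bivector.push A (B - B') = Bivector.push A B - Bivector.push A B' := rfl

variable {E : Type*} [NormedAddCommGroup E] [NormedSpace ℝ E]
  {K : Type*} [TopologicalSpace K] [ChartedSpace E K] [Group K] [LieGroup 𝓘(ℝ, E) ∞ K]

/-- Left translation by `w`, as a diffeomorphism. -/
def leftTranslation (w : K) : K ≃ₘ⟮𝓘(ℝ, E), 𝓘(ℝ, E)⟯ K where
  toEquiv := Equiv.mulLeft w
  contMDiff_toFun := contMDiff_mul_left
  contMDiff_invFun := contMDiff_mul_left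

lemma push_leftInvariant (w k : K) (r : Bivector (GroupLieAlgebra 𝓘(ℝ, E) K)) :
    Bivector.push (mfderiv 𝓘(ℝ, E) 𝓘(ℝ, E) (leftTranslation (E := E) w) k).toLinearMap
      (leftInvariant r k) = leftInvariant r (w * k) := by
  have h := mfderiv_comp_model (E := E) (E' := E) (E'' := E) (x := (1 : K)) (y := k)
    (g := fun h : K => w * h) (f := fun h : K => k * h) (mul_one k)
    (mdifferentiableAt_mul_left w k) (mdifferentiableAt_mul_left k 1)
  have h2 : (fun x : K => w * (k * x)) = fun x => w * k * x := by
    ext x; rw [mul_assoc]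
  rw [h2] at h
  exact (congrArg (fun T : E →L[ℝ] E => Bivector.push (V := E) (V' := E) T.toLinearMap r) h).symm

/-- Left translation of a right-invariant bivector field: the generating bivector is moved by
the adjoint action, since `w (g k) = (w g w⁻¹) (w k)`. -/
lemma push_rightInvariant (w k : K) (r : Bivector (GroupLieAlgebra 𝓘(ℝ, E) K)) :
    Bivector.push (mfderiv 𝓘(ℝ, E) 𝓘(ℝ, E) (leftTranslation (E := E) w) k).toLinearMap
      (rightInvariant r k) = rightInvariant (Bivector.push (Ad w) r) (w * k) := by
  have h := mfderiv_comp_model (E := E) (E' := E) (E'' := E) (x := (1 : K)) (y := k)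
    (g := fun h : K => w * h) (f := fun h : K => h * k) (one_mul k)
    (mdifferentiableAt_mul_left w k) (mdifferentiableAt_mul_right k 1)
  have h' := mfderiv_comp_model (E := E) (E' := E) (E'' := E) (x := (1 : K)) (y := (1 : K))
    (g := fun h : K => h * (w * k)) (f := fun h : K => w * h * w⁻¹) (by simp)
    (mdifferentiableAt_mul_right (w * k) 1) (mdifferentiableAt_conj w 1)
  have h2 : (fun x : K => w * x * w⁻¹ * (w * k)) = fun x => w * (x * k) := by
    ext x; group
  rw [h2] at h'
  exact congrArg (fun T : E →L[ℝ] E => Bivector.push (V := E) (V' := E) T.toLinearMap r)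
    (h.symm.trans h')

lemma carries_leftTranslation [FiniteDimensional ℝ E]
    {D : TriangularDecomposition (GroupLieAlgebra 𝓘(ℝ, E) K)} {w : K}
    (hw : Bivector.push (Ad w) D.hilbertBivector = -D.hilbertBivector) :
    Carries (leftTranslation (E := E) w) (standardPoisson D) (-evensLu D) := by
  intro k
  refine (Bivector.push_sub _ _ _).trans ?_
  rw [push_leftInvariant, push_rightInvariant, hw]
  change rightInvariant (-D.hilbertBivector) (w * k) - leftInvariant D.hilbertBivector (w * k) =
    -(rightInvariant D.hilbertBivector (w * k) + leftInvariant D.hilbertBivector (w * k))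
  rw [neg_add, ← sub_eq_add_neg]
  rfl

end Bivectors

/-! ### The complexification and the strata -/

section Complex

variable {F : Type*} [NormedAddCommGroup F] [NormedSpace ℂ F]
  {G : Type*} [TopologicalSpace G] [ChartedSpace F G]

lemma contMDiff_restrictScalars {f : G → G} (hf : ContMDiff 𝓘(ℂ, F) 𝓘(ℂ, F) ∞ f) :
    ContMDiff 𝓘(ℝ, F) 𝓘(ℝ, F) ∞ f :=
  fun x => ⟨(hf x).1, ContDiffWithinAt.restrict_scalars ℝ (hf x).2⟩

lemma mfderiv_restrictScalars {f : G → G} {x : G}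
    (hf : MDifferentiableAt 𝓘(ℂ, F) 𝓘(ℂ, F) f x) :
    (mfderiv 𝓘(ℝ, F) 𝓘(ℝ, F) f x : F →L[ℝ] F) =
      (mfderiv 𝓘(ℂ, F) 𝓘(ℂ, F) f x : F →L[ℂ] F).restrictScalars ℝ := by
  have h : HasMFDerivAt 𝓘(ℝ, F) 𝓘(ℝ, F) f x
      ((mfderiv 𝓘(ℂ, F) 𝓘(ℂ, F) f x : F →L[ℂ] F).restrictScalars ℝ) :=
    ⟨hf.hasMFDerivAt.1, HasFDerivWithinAt.restrictScalars ℝ hf.hasMFDerivAt.2⟩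
  exact h.mfderiv

variable [Group G] {E : Type*} [NormedAddCommGroup E] [NormedSpace ℝ E]
  {K : Type*} [TopologicalSpace K] [ChartedSpace E K] [Group K] [LieGroup 𝓘(ℝ, E) ∞ K]

variable (F) in
/-- The adjoint action of the complex group `G`, as a complex-linear map of the model space. -/
def adC (g : G) : F →L[ℂ] F := mfderiv 𝓘(ℂ, F) 𝓘(ℂ, F) (fun h : G => g * h * g⁻¹) 1

variable (E F) in
/-- The differential of a homomorphism at the unit, as a map of the model spaces. -/
def diffR (ι : K →* G) : E →L[ℝ] F := mfderiv 𝓘(ℝ, E) 𝓘(ℝ, F) ι 1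

omit [LieGroup 𝓘(ℝ, E) ∞ K] in
lemma diffC_tmul (ι : K →* G) (z : ℂ) (X : GroupLieAlgebra 𝓘(ℝ, E) K) :
    diffC (E := E) (F := F) ι (z ⊗ₜ[ℝ] X) = z • diffR F E ι X :=
  LinearMap.liftBaseChange_tmul (R := ℝ) (M := E) (N := F) ℂ (diffR F E ι).toLinearMap z X

lemma contMDiff_conj_complex [LieGroup 𝓘(ℂ, F) ∞ G] (g : G) :
    ContMDiff 𝓘(ℂ, F) 𝓘(ℂ, F) ∞ (fun h : G => g * h * g⁻¹) :=
  (contMDiff_const.mul contMDiff_id).mul contMDiff_const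

lemma mfderiv_conj_eq_adC [LieGroup 𝓘(ℂ, F) ∞ G] (g : G) :
    (mfderiv 𝓘(ℝ, F) 𝓘(ℝ, F) (fun h : G => g * h * g⁻¹) 1 : F →L[ℝ] F) =
      (adC F g).restrictScalars ℝ :=
  mfderiv_restrictScalars ((contMDiff_conj_complex g).contMDiffAt.mdifferentiableAt (by simp))

/-- The differential of `ι` intertwines the adjoint actions. It suffices to know this on the Lie
algebra of `K`, because the adjoint action of the complex group `G` is complex linear. -/
lemma adC_diffC {ι : K →* G} (hι : IsComplexification E F ι) (k : K)
    (Z : ℂ ⊗[ℝ] GroupLieAlgebra 𝓘(ℝ, E) K) :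
    adC F (ι k) (diffC (E := E) (F := F) ι Z) =
      diffC (E := E) (F := F) ι ((Ad k).baseChange ℂ Z) := by
  have := hι.lieGroup
  have hc := contMDiff_restrictScalars (contMDiff_conj_complex (F := F) (ι k))
  have hιd : MDifferentiableAt 𝓘(ℝ, E) 𝓘(ℝ, F) ι 1 :=
    hι.smooth.contMDiffAt.mdifferentiableAt (by simp)
  have hreal : ∀ X : E, adC F (ι k) (diffR F E ι X) = diffR F E ι (AdE E k X) := fun X => by
    have h1 := mfderiv_comp_model_apply (E := E) (E' := F) (E'' := F) (x := (1 : K)) (y := (1 : G))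
      (map_one ι) (hc.contMDiffAt.mdifferentiableAt (by simp)) hιd X
    have h2 := mfderiv_comp_model_apply (E := E) (E' := E) (E'' := F) (x := (1 : K)) (y := (1 : K))
      (g := ι) (f := fun g : K => k * g * k⁻¹) (by simp) hιd (mdifferentiableAt_conj k 1) X
    have h3 : (fun x : K => ι (k * x * k⁻¹)) = fun x => ι k * ι x * (ι k)⁻¹ := by
      ext x; simp
    rw [h3] at h2
    have h4 := congrArg (fun T : F →L[ℝ] F => T (diffR F E ι X))
      (mfderiv_conj_eq_adC (F := F) (ι k))
    exact h4.symm.trans (h1.symm.trans h2)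
  induction Z with
  | zero => simp
  | tmul z X =>
    rw [LinearMap.baseChange_tmul, diffC_tmul, diffC_tmul, map_smul]
    exact congrArg (fun v : F => z • v) (hreal X)
  | add a b ha hb => rw [map_add, map_add, ha, hb, map_add, map_add]

lemma conj_mem_expG {ι : K →* G} (hι : IsComplexification E F ι) {k : K}
    {s s' : Submodule ℂ (ℂ ⊗[ℝ] GroupLieAlgebra 𝓘(ℝ, E) K)}
    (hs : ∀ Z ∈ s, (Ad k).baseChange ℂ Z ∈ s') {n : G} (hn : n ∈ expG F ι s) :
    ι k * n * (ι k)⁻¹ ∈ expG F ι s' := by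
  have := hι.lieGroup
  obtain ⟨γ, _, ⟨Z, hZ, rfl⟩, hγ, rfl⟩ := mem_expSet.1 hn
  have hc := contMDiff_restrictScalars (contMDiff_conj_complex (F := F) (ι k))
  refine mem_expSet.2 ⟨fun s => ι k * γ s * (ι k)⁻¹, _, ⟨_, hs Z hZ, rfl⟩,
    ⟨hc.comp hγ.smooth, fun a b => ?_, ?_⟩, rfl⟩
  · rw [hγ.add]; group
  · have h1 := mfderiv_comp_model_apply (E := ℝ) (E' := F) (E'' := F) (x := (0 : ℝ)) (y := (1 : G))
      (f := γ) hγ.zero (hc.contMDiffAt.mdifferentiableAt (by simp)) (hγ.mdifferentiableAt 0) 1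
    have h2 := congrArg (fun T : F →L[ℝ] F => T (mfderiv 𝓘(ℝ, ℝ) 𝓘(ℝ, F) γ 0 (1 : ℝ) : F))
      (mfderiv_conj_eq_adC (F := F) (ι k))
    exact (h1.trans h2).trans ((congrArg (adC F (ι k)) hγ.deriv).trans (adC_diffC hι k Z))

end Complex

open scoped Pointwise in
lemma mul_mem_double_coset_iff {G : Type*} [Group G] {N N' H P : Set G} {a b x : G}
    (hN : ∀ n, n ∈ N ↔ a * n * a⁻¹ ∈ N') :
    x ∈ N * {b} * H * P ↔ a * x ∈ N' * {a * b} * H * P := by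
  constructor
  · rintro ⟨_, ⟨_, ⟨n, hn, _, rfl, rfl⟩, h, hh, rfl⟩, p, hp, rfl⟩
    refine ⟨_, ⟨_, ⟨a * n * a⁻¹, (hN n).1 hn, _, rfl, rfl⟩, h, hh, rfl⟩, p, hp, ?_⟩
    group
  · rintro ⟨_, ⟨_, ⟨n, hn, _, rfl, rfl⟩, h, hh, rfl⟩, p, hp, hx⟩
    refine ⟨_, ⟨_, ⟨a⁻¹ * n * a, (hN _).2 ?_, _, rfl, rfl⟩, h, hh, rfl⟩, p, hp, ?_⟩
    · have h1 : a * (a⁻¹ * n * a) * a⁻¹ = n := by group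
      rwa [h1]
    · rw [← inv_mul_cancel_left a x, ← hx]
      group

open scoped Pointwise in
lemma image_mul_left_preimage {K G : Type*} [Group K] [Group G] (ι : K →* G)
    {N N' H P : Set G} (w₀ w : K) (hN : ∀ n, n ∈ N ↔ ι w₀ * n * (ι w₀)⁻¹ ∈ N') :
    (w₀ * ·) '' (ι ⁻¹' (N * {ι w} * H * P)) = ι ⁻¹' (N' * {ι (w₀ * w)} * H * P) := by
  rw [Set.image_mul_left]
  ext x
  simp only [Set.mem_preimage]
  rw [mul_mem_double_coset_iff hN, ← map_mul, ← map_mul, mul_inv_cancel_left]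

section Strata

variable {E : Type*} [NormedAddCommGroup E] [NormedSpace ℝ E] [FiniteDimensional ℝ E]
  {K : Type*} [TopologicalSpace K] [T2Space K] [ChartedSpace E K] [Group K]
  [LieGroup 𝓘(ℝ, E) ∞ K] [CompleteSpace E]
  {F : Type*} [NormedAddCommGroup F] [NormedSpace ℂ F]
  {G : Type*} [TopologicalSpace G] [ChartedSpace F G] [Group G]
  {D : TriangularDecomposition (GroupLieAlgebra 𝓘(ℝ, E) K)}

omit [FiniteDimensional ℝ E] in
lemma mem_expG_iff_conj {ι : K →* G} (hι : IsComplexification E F ι) {k : K}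
    {s s' : Submodule ℂ (ℂ ⊗[ℝ] GroupLieAlgebra 𝓘(ℝ, E) K)}
    (hs : (Ad k).baseChange ℂ '' (s : Set (ℂ ⊗[ℝ] GroupLieAlgebra 𝓘(ℝ, E) K)) = s') (n : G) :
    n ∈ expG F ι s ↔ ι k * n * (ι k)⁻¹ ∈ expG F ι s' := by
  refine ⟨fun hn => conj_mem_expG hι (fun Z hZ => hs.subset ⟨Z, hZ, rfl⟩) hn, fun hn => ?_⟩
  have h1 := conj_mem_expG hι (k := k⁻¹) (s' := s) (fun Z hZ => by
    obtain ⟨W, hW, rfl⟩ := hs.superset hZ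
    have h2 := baseChange_apply_symm (AdEquiv k).symm W
    exact (congrArg (· ∈ s) h2).mpr hW) hn
  have h2 : ι k⁻¹ * (ι k * n * (ι k)⁻¹) * (ι k⁻¹)⁻¹ = n := by
    rw [map_inv]; group
  rwa [h2] at h1

lemma image_bruhat {ι : K →* G} (hι : IsComplexification E F ι) {w₀ : K}
    (h : D.Reverses (AdEquiv w₀)) (w : K) :
    (w₀ * ·) '' bruhat F D ι w = birkhoff F D ι (w₀ * w) :=
  image_mul_left_preimage ι w₀ w (mem_expG_iff_conj hι h.image_nPos)

lemma image_birkhoff {ι : K →* G} (hι : IsComplexification E F ι) {w₀ : K}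
    (h : D.Reverses (AdEquiv w₀)) (w : K) :
    (w₀ * ·) '' birkhoff F D ι w = bruhat F D ι (w₀ * w) :=
  image_mul_left_preimage ι w₀ w (mem_expG_iff_conj hι h.image_nNeg)

end Strata

end CompactPoisson

end

theorem mainTheorem7 {E : Type*} [NormedAddCommGroup E] [NormedSpace ℝ E] [FiniteDimensional ℝ E]
    {K : Type*} [TopologicalSpace K] [T2Space K] [ChartedSpace E K] [Group K]
    [LieGroup 𝓘(ℝ, E) ∞ K] [CompactSpace K] [SimplyConnectedSpace K]
    (D : CompactPoisson.TriangularDecomposition (GroupLieAlgebra 𝓘(ℝ, E) K))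
    (w₀ : K) (hw₀ : CompactPoisson.IsLongestRep D w₀) :
    (∃ Φ : K ≃ₘ⟮𝓘(ℝ, E), 𝓘(ℝ, E)⟯ K, (∀ k, Φ k = w₀ * k) ∧
      CompactPoisson.Carries Φ (CompactPoisson.standardPoisson D) (-CompactPoisson.evensLu D)) ∧
    (∀ (F : Type*) [NormedAddCommGroup F] [NormedSpace ℂ F]
      (G : Type*) [TopologicalSpace G] [ChartedSpace F G] [Group G] (ι : K →* G),
      CompactPoisson.IsComplexification E F ι →
      ∀ w ∈ CompactPoisson.torusNormalizer D,
        (w₀ * ·) '' CompactPoisson.bruhat F D ι w = CompactPoisson.birkhoff F D ι (w₀ * w) ∧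
        (w₀ * ·) '' CompactPoisson.birkhoff F D ι w = CompactPoisson.bruhat F D ι (w₀ * w)) := by
  have : CompleteSpace E := FiniteDimensional.complete ℝ E
  have hrev := hw₀.reverses
  exact ⟨⟨CompactPoisson.leftTranslation w₀, fun _ => rfl,
    CompactPoisson.carries_leftTranslation hrev.push_hilbertBivector⟩,
    fun F _ _ G _ _ _ ι hι w _ =>
      ⟨CompactPoisson.image_bruhat hι hrev w, CompactPoisson.image_birkhoff hι hrev w⟩⟩
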